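/- Let $(\Omega,\mathcal F,(\mathcal F_t),\mathbb P)$ be a filtered probability space satisfying the usual conditions, $T>0$, and let $\mathcal D_T\in L^2(\mathcal F_T)$ be the dividend of a risky asset, with (càdlàg) expected dividend $\mathcal D_t=\mathbb E[\mathcal D_T\mid\mathcal F_t]$. Write $\mathcal L^2$ and $\mathcal S^2$ for the predictable processes $X$ with $\mathbb E[\int_0^TX_t^2dt]<\infty$ and $\mathbb E[\sup_{t\le T}X_t^2]<\infty$, respectively, and $\mathcal H^2$ for the semimartingales $S=S_0+N+A$ with $S_0$ being $\mathcal F_0$-measurable, $N$ a square-integrable martingale and $A$ (the drift of $S$) predictable of finite variation with square-integrable total variation, $N_0=A_0=0$. Fix an integer $M\ge 1$ and $\rho_d>0$. For $\lambda>0$ consider $M$ dealers $a=1,\dots,M$, each of mass $1/M$ and risk tolerance $\rho_d$, without trading targets or individual trading costs. If dealer $a$ holds $K\in\mathcal S^2$ in the dealer market with price $S\in\mathcal H^2$ (with drift $A$) and trades at rate $u\in\mathcal L^2$ in the open market, while the other dealers' aggregate open-market trading rate is $v$, her goal functional is $$J^a(K,u;v,S)=\mathbb E\Big[\int_0^TK_t\,dA_t-\int_0^T\Big(\lambda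 v_tu_t+\frac{\lambda}{M}u_t^2\Big)dt\Big]-\mathbb E\Big[\int_0^T\frac1{2\rho_d}\Big(K_t+\int_0^tu_s\,ds\Big)^2dt\Big].$$ For an exogenous noise-trader demand $K^N$, an equilibrium consists of a price $S\in\mathcal H^2$ with $S_T=\mathcal D_T$ and strategies $(K^a,u^a)\in\mathcal S^2\times\mathcal L^2$, $a=1,\dots,M$, such that the dealer market clears, $K^N+\frac1M\sum_aK^a=0$, and, for each $a$, $(K^a,u^a)$ maximizes $J^a(\cdot,\cdot\,;\bar u^{-a},S)$ over $\mathcal S^2\times\mathcal L^2$, where $\bar u^{-a}=\frac1M\sum_{b\ne a}u^b$. Let $K^N_t=\int_0^t\mu^N_s\,ds$, $t\in[0,T]$, for a continuous process $\mu^N\in\mathcal S^2$. Then the stochastic integral $\int_0^TK^N_t\,d\mathcal D_t$ exists, as does $\int_0^TK^N_t\,dS^\lambda_t$ for every equilibrium price $S^\lambda$ with price impact parameter $\lambda>0$, and the liquidity costs satisfy $$\int_0^TK^N_t\,d\mathcal D_t-\int_0^TK^N_t\,dS^\lambda_t=\lambda\,\frac{M+1}{M}\int_0^T(\mu^N_t)^2\,dt+o(\lambda)\quad\text{in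 }L^1\text{ as }\lambda\to0,$$ that is, for every $\varepsilon>0$ there is $\lambda_0>0$ such that, for every $0<\lambda<\lambda_0$ and every equilibrium price $S^\lambda$, the difference of the left-hand side and of $\lambda\frac{M+1}{M}\int_0^T(\mu^N_t)^2dt$ is integrable with $L^1$-norm at most $\varepsilon\lambda$. -/

import Mathlib

open MeasureTheory ProbabilityTheory Filter Topology
open scoped NNReal ENNReal

noncomputable section

namespace DealerMarket

/-! Time is `ℝ≥0`; only the part `[0, T]` of a process or of a filtration plays a role.
A process is a map `ℝ≥0 → Ω → ℝ`. -/

/-! ### Filtrations, path regularity, spaces of processes -/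

/-- The usual conditions: right-continuity of the filtration, and completeness (every subset of a
null set belongs to `𝓕 0`; `P` of an arbitrary set is its outer measure). -/
structure UsualConditions {Ω : Type*} [mΩ : MeasurableSpace Ω] (P : Measure Ω)
    (𝓕 : Filtration ℝ≥0 mΩ) : Prop where
  rightContinuous : 𝓕.IsRightContinuous
  complete : ∀ s : Set Ω, P s = 0 → MeasurableSet[𝓕 0] s

/-- The path `f` is right-continuous with left limits on `[0, T]`. -/
def IsCadlagOn (T : ℝ≥0) (f : ℝ≥0 → ℝ) : Prop :=
  (∀ t < T, ContinuousWithinAt f (Set.Ici t) t) ∧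
    ∀ t, 0 < t → t ≤ T → ∃ l : ℝ, Tendsto f (𝓝[<] t) (𝓝 l)

/-- `timeInt X t ω = ∫₀ᵗ X_s(ω) ds`. -/
def timeInt {Ω : Type*} (X : ℝ≥0 → Ω → ℝ) (t : ℝ≥0) (ω : Ω) : ℝ :=
  ∫ s in (0 : ℝ)..(t : ℝ), X s.toNNReal ω

/-- The space `𝓛²`: predictable processes with `E[∫₀ᵀ X_t² dt] < ∞`. -/
def MemL2 {Ω : Type*} [mΩ : MeasurableSpace Ω] (P : Measure Ω) (𝓕 : Filtration ℝ≥0 mΩ) (T : ℝ≥0)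
    (X : ℝ≥0 → Ω → ℝ) : Prop :=
  IsStronglyPredictable 𝓕 X ∧
    ∫⁻ ω, (∫⁻ s in Set.Icc (0 : ℝ) T, ‖X s.toNNReal ω‖ₑ ^ 2) ∂P < ⊤

/-- The space `𝓢²`: predictable processes with `E[sup_{t ∈ [0,T]} X_t²] < ∞`. -/
def MemS2 {Ω : Type*} [mΩ : MeasurableSpace Ω] (P : Measure Ω) (𝓕 : Filtration ℝ≥0 mΩ) (T : ℝ≥0)
    (X : ℝ≥0 → Ω → ℝ) : Prop :=
  IsStronglyPredictable 𝓕 X ∧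
    ∫⁻ ω, (⨆ t ∈ Set.Icc (0 : ℝ≥0) T, ‖X t ω‖ₑ ^ 2) ∂P < ⊤

/-- `S` belongs to `𝓗²` with drift `A`: on `[0, T]`, `S = S₀ + M + A` where `S₀` is
`𝓕₀`-measurable, `M` is a square-integrable càdlàg martingale null at `0`, and `A` is predictable,
càdlàg, null at `0`, with paths of finite variation and square-integrable total variation. -/
def IsH2WithDrift {Ω : Type*} [mΩ : MeasurableSpace Ω] (P : Measure Ω) (𝓕 : Filtration ℝ≥0 mΩ)
    (T : ℝ≥0) (S A : ℝ≥0 → Ω → ℝ) : Prop :=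
  StronglyMeasurable[𝓕 0] (S 0) ∧
  (∃ M : ℝ≥0 → Ω → ℝ, Martingale M 𝓕 P ∧ MemLp (M T) 2 P ∧
    (∀ ω, M 0 ω = 0) ∧ (∀ ω, IsCadlagOn T fun t => M t ω) ∧
    ∀ᵐ ω ∂P, ∀ t ≤ T, S t ω = S 0 ω + M t ω + A t ω) ∧
  IsStronglyPredictable 𝓕 A ∧ (∀ ω, A 0 ω = 0) ∧ (∀ ω, IsCadlagOn T fun t => A t ω) ∧
  (∀ ω, BoundedVariationOn (fun t => A t ω) (Set.Icc 0 T)) ∧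
  ∫⁻ ω, (eVariationOn (fun t => A t ω) (Set.Icc 0 T)) ^ 2 ∂P < ⊤

/-! ### Integrals -/

open Classical in
/-- The Lebesgue–Stieltjes integral `∫_{(0,T]} f da` with respect to a right-continuous path `a` of
finite variation on `[0, T]`. -/
def lsIntegral (T : ℝ≥0) (f a : ℝ≥0 → ℝ) : ℝ :=
  if h : BoundedVariationOn (fun t => a (min t T)) Set.univ then
    VectorMeasure.integral (h.vectorMeasure.restrict (Set.Ioc 0 T)) f
      (ContinuousLinearMap.lsmul ℝ ℝ)
  else 0

/-- A finite partition `0 = t₀ ≤ t₁ ≤ … ≤ tₙ = T`. -/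
structure TimePartition (T : ℝ≥0) where
  n : ℕ
  point : ℕ → ℝ≥0
  mono : Monotone point
  point_zero : point 0 = 0
  point_last : point n = T

/-- The largest step `max_i (t_{i+1} - t_i)` of a partition. -/
def TimePartition.mesh {T : ℝ≥0} (π : TimePartition T) : ℝ≥0 :=
  (Finset.range π.n).sup fun i => π.point (i + 1) - π.point i

/-- The left-point sum `∑_i K_{t_i} (X_{t_{i+1}} - X_{t_i})`. -/
def itoSum {Ω : Type*} {T : ℝ≥0} (K X : ℝ≥0 → Ω → ℝ) (π : TimePartition T) (ω : Ω) : ℝ :=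
  ∑ i ∈ Finset.range π.n, K (π.point i) ω * (X (π.point (i + 1)) ω - X (π.point i) ω)

/-- The random variable `I` is (a version of) the stochastic integral `∫₀ᵀ K dX` of an adapted
integrand `K` with continuous paths against a semimartingale `X`: along every sequence of
partitions whose mesh tends to `0`, the left-point sums converge to `I` in probability. -/
def IsStochasticIntegral {Ω : Type*} [MeasurableSpace Ω] (P : Measure Ω) (T : ℝ≥0)
    (K X : ℝ≥0 → Ω → ℝ) (I : Ω → ℝ) : Prop :=
  AEStronglyMeasurable I P ∧
    ∀ π : ℕ → TimePartition T, Tendsto (fun j => (π j).mesh) atTop (𝓝 0) →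
      TendstoInMeasure P (fun j => itoSum K X (π j)) atTop I

/-! ### The market -/

/-- `D` is the unaffected price `D_t = E[𝒟_T | 𝓕_t]`, `t ∈ [0, T]`, in its càdlàg version. -/
def IsExpectedDividend {Ω : Type*} [mΩ : MeasurableSpace Ω] (P : Measure Ω)
    (𝓕 : Filtration ℝ≥0 mΩ) (T : ℝ≥0) (DT : Ω → ℝ) (D : ℝ≥0 → Ω → ℝ) : Prop :=
  (∀ t ≤ T, D t =ᵐ[P] P[DT | 𝓕 t]) ∧ ∀ᵐ ω ∂P, IsCadlagOn T fun t => D t ω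

/-- The characteristics of the agents: masses `m(a)`, idiosyncratic trading costs `λ^a`,
risk tolerances `ρ^a` and target positions `ξ^a`. -/
structure Agents (ι Ω : Type*) where
  mass : ι → ℝ
  cost : ι → ℝ
  tol : ι → ℝ
  target : ι → ℝ≥0 → Ω → ℝ

/-- The other agents' aggregate trading rate `ū^{-a} = ∑_b m(b) u^b - m(a) u^a`. -/
def Agents.othersRate {ι Ω : Type*} [Fintype ι] (G : Agents ι Ω) (u : ι → ℝ≥0 → Ω → ℝ) (a : ι) :
    ℝ≥0 → Ω → ℝ :=
  fun t ω => ∑ b, G.mass b * u b t ω - G.mass a * u a t ω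

/-- The goal functional `J^a(K, u; v, S)` of agent `a` who holds `K` in the dealer market and trades
at rate `u` in the open market, where `v` is the other agents' aggregate trading rate, `A` the drift
of the price `S` in the dealer market, and `lam` the price impact in the open market. -/
def Agents.goal {ι Ω : Type*} [MeasurableSpace Ω] (G : Agents ι Ω) (P : Measure Ω) (T : ℝ≥0)
    (lam : ℝ) (A v : ℝ≥0 → Ω → ℝ) (a : ι) (K u : ℝ≥0 → Ω → ℝ) : ℝ :=
  (∫ ω, (lsIntegral T (fun t => K t ω) (fun t => A t ω)
      - timeInt (fun t ω => lam * v t ω * u t ω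
          + (lam * G.mass a + G.cost a / 2) * (u t ω) ^ 2) T ω) ∂P)
    - ∫ ω, timeInt (fun t ω => 1 / (2 * G.tol a)
          * (G.target a t ω - K t ω - timeInt u t ω) ^ 2) T ω ∂P

/-- `(S, (K^a, u^a)_a)` is an equilibrium for the impact parameter `lam`, the noise traders' demand
`KN` and the terminal dividend `DT`: the price `S` belongs to `𝓗²` and matches the dividend at
time `T`, the strategies are admissible, the dealer market clears, and the strategies form an
open-loop Nash equilibrium. -/
def IsEquilibrium {ι Ω : Type*} [Fintype ι] [mΩ : MeasurableSpace Ω] (P : Measure Ω)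
    (𝓕 : Filtration ℝ≥0 mΩ) (T : ℝ≥0) (DT : Ω → ℝ) (G : Agents ι Ω) (lam : ℝ)
    (KN S : ℝ≥0 → Ω → ℝ) (K u : ι → ℝ≥0 → Ω → ℝ) : Prop :=
  S T =ᵐ[P] DT ∧
  (∀ a, MemS2 P 𝓕 T (K a) ∧ MemL2 P 𝓕 T (u a)) ∧
  (∀ᵐ ω ∂P, ∀ t ≤ T, KN t ω + ∑ a, G.mass a * K a t ω = 0) ∧
  ∃ A : ℝ≥0 → Ω → ℝ, IsH2WithDrift P 𝓕 T S A ∧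
    ∀ a, ∀ K' u' : ℝ≥0 → Ω → ℝ, MemS2 P 𝓕 T K' → MemL2 P 𝓕 T u' →
      G.goal P T lam A (G.othersRate u a) a K' u'
        ≤ G.goal P T lam A (G.othersRate u a) a (K a) (u a)

/-- `M` identical dealers with mass `1 / M`, risk tolerance `ρd`, no idiosyncratic trading costs
and no trading targets. -/
def dealers (Ω : Type*) (M : ℕ) (ρd : ℝ) : Agents (Fin M) Ω where
  mass := fun _ => 1 / (M : ℝ)
  cost := fun _ => 0
  tol := fun _ => ρd
  target := fun _ _ _ => 0

end DealerMarket

end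

/-!
Let `ū` be the dealers' average trading rate, `w = ū - μN`, `X_t = ∫₀ᵗ w ds` and `c = (M + 1) / M`.
By market clearing, `X` is the dealers' aggregate exposure. The goal functionals are quadratic, so
optimality gives linear first-order conditions (`firstOrder`); averaged over the dealers
(`aggregate_firstOrder`), they say that

* the drift of the price is `dA = ρd⁻¹ X dt`, tested against bounded predictable positions;
* `λ c ū + ρd⁻¹ ∫_t^T X ds` is orthogonal to all predictable rates, that is, `-λ c ū` is the
  predictable projection of `ρd⁻¹ ∫_t^T X ds`.

As `S_T = D_T`, the first point gives `D_t - S_t = E[A_T - A_t | 𝓕_t] = ρd⁻¹ E[∫_t^T X ds | 𝓕_t]`.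
This process is càdlàg, hence coincides `P ⊗ dt`-almost everywhere with its left limits and is its
own predictable projection (`ae_add_eq_zero_of_orthogonal`). By the second point, `D - S = -λ c ū`
almost everywhere (`IsEquilibrium.ae_rate_eq`).

Since `KN` is absolutely continuous, its stochastic integrals are given by integration by parts
(`isStochasticIntegral_of_cadlag`), and the liquidity costs are
`-∫ (D - S) μN dt = λ c ∫ ū μN dt` (`IsEquilibrium.ae_liquidityCost_eq`). They differ from
`λ c ∫ (μN)² dt` by `λ c ∫ w μN dt`, so it remains to show that `w → 0` in `L²(P ⊗ dt)` as `λ → 0`.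
With `w` as test rate, the first-order condition becomes `κ ⟨w + μN, w⟩ + ‖X‖² = 0` for
`κ = λ c ρd`. Hence `‖w‖² ≤ |⟨μN, w⟩|`, `‖w‖ ≤ ‖μN‖` and `‖X‖² ≤ κ ‖μN‖²` (`energy_bounds`). The
primitive `X_t` is then small in `L²(P)`, uniformly in `t`, and since `μN` can be approximated by
bounded step processes, `⟨μN, w⟩ → 0` (`exists_weak_bound`, `exists_energy_small`).

The measurability in `ω` of the Lebesgue–Stieltjes integrals `∫ K dA`, needed to make sense of the
first-order conditions, follows from the measurability of the variation of a right-continuous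
process (`measurable_eVariationOn`).
-/

noncomputable section

namespace DealerMarket

/-! ### The time axis -/

/-- Lebesgue measure on the time axis `ℝ≥0`, pulled back from `ℝ` so that time integrals are taken
over the index set of the processes. -/
def lebesgue : Measure ℝ≥0 := Measure.comap ((↑) : ℝ≥0 → ℝ) volume

lemma measurableEmbedding_coe : MeasurableEmbedding ((↑) : ℝ≥0 → ℝ) :=
  MeasurableEmbedding.subtype_coe measurableSet_Ici

lemma measurePreserving_coe :
    MeasurePreserving ((↑) : ℝ≥0 → ℝ) lebesgue (volume.restrict (Set.Ici 0)) :=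
  measurePreserving_subtype_coe measurableSet_Ici

lemma coe_preimage_Ioc (a b : ℝ≥0) :
    ((↑) : ℝ≥0 → ℝ) ⁻¹' Set.Ioc (a : ℝ) (b : ℝ) = Set.Ioc a b := by
  ext s; simp

lemma restrict_Ici_restrict_Ioc (b : ℝ≥0) :
    ((volume : Measure ℝ).restrict (Set.Ici 0)).restrict (Set.Ioc 0 (b : ℝ))
      = volume.restrict (Set.Ioc 0 (b : ℝ)) := by
  rw [Measure.restrict_restrict measurableSet_Ioc, Set.inter_eq_left.2]
  exact fun s hs => hs.1.le

lemma setIntegral_lebesgue (g : ℝ≥0 → ℝ) (t : ℝ≥0) :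
    ∫ s in Set.Ioc (0 : ℝ) t, g s.toNNReal = ∫ s in Set.Ioc 0 t, g s ∂lebesgue := by
  have h := measurePreserving_coe.setIntegral_preimage_emb measurableEmbedding_coe
    (fun s : ℝ => g s.toNNReal) (Set.Ioc (0 : ℝ) t)
  rw [restrict_Ici_restrict_Ioc] at h
  rw [← h]
  have := coe_preimage_Ioc 0 t
  simp only [NNReal.coe_zero] at this
  rw [this]
  simp

lemma setLIntegral_lebesgue (g : ℝ≥0 → ℝ≥0∞) (t : ℝ≥0) :
    ∫⁻ s in Set.Icc (0 : ℝ) t, g s.toNNReal = ∫⁻ s in Set.Ioc 0 t, g s ∂lebesgue := by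
  rw [← restrict_Ioc_eq_restrict_Icc]
  have h := measurePreserving_coe.setLIntegral_comp_preimage_emb measurableEmbedding_coe
    (fun s : ℝ => g s.toNNReal) (Set.Ioc (0 : ℝ) t)
  rw [restrict_Ici_restrict_Ioc] at h
  rw [← h]
  have := coe_preimage_Ioc 0 t
  simp only [NNReal.coe_zero] at this
  rw [this]
  simp

lemma timeInt_eq {Ω : Type*} (X : ℝ≥0 → Ω → ℝ) (t : ℝ≥0) (ω : Ω) :
    timeInt X t ω = ∫ s in Set.Ioc 0 t, X s ω ∂lebesgue := by
  rw [timeInt, intervalIntegral.integral_of_le (NNReal.coe_nonneg t)]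
  exact setIntegral_lebesgue (fun s => X s ω) t

lemma lebesgue_Ioc (a b : ℝ≥0) : lebesgue (Set.Ioc a b) = ENNReal.ofReal (b - a) := by
  rw [← coe_preimage_Ioc, measurePreserving_coe.measure_preimage_emb measurableEmbedding_coe,
    Measure.restrict_apply measurableSet_Ioc, Set.inter_eq_left.2, Real.volume_Ioc]
  exact fun s hs => a.2.trans hs.1.le

instance : NullSingletonClass lebesgue where
  measure_singleton a := by
    have : ({a} : Set ℝ≥0) = ((↑) : ℝ≥0 → ℝ) ⁻¹' {(a : ℝ)} := by ext; simp
    rw [this, measurePreserving_coe.measure_preimage_emb measurableEmbedding_coe]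
    simp

/-- Lebesgue measure on the trading period `(0, T]`. -/
def timeMeasure (T : ℝ≥0) : Measure ℝ≥0 := lebesgue.restrict (Set.Ioc 0 T)

instance (T : ℝ≥0) : IsFiniteMeasure (timeMeasure T) :=
  ⟨by rw [timeMeasure, Measure.restrict_apply_univ, lebesgue_Ioc]; exact ENNReal.ofReal_lt_top⟩

instance (T : ℝ≥0) : NullSingletonClass (timeMeasure T) := by
  unfold timeMeasure; infer_instance

lemma ae_timeMeasure_mem (T : ℝ≥0) : ∀ᵐ s ∂timeMeasure T, s ∈ Set.Ioc 0 T :=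
  ae_restrict_mem measurableSet_Ioc

/-! ### Step functions on partitions -/

namespace TimePartition

variable {T : ℝ≥0} (π : TimePartition T)

/-- The step function with value `c i` on `(t_i, t_{i+1}]`. -/
def step (c : ℕ → ℝ) (s : ℝ≥0) : ℝ :=
  ∑ i ∈ Finset.range π.n, (Set.Ioc (π.point i) (π.point (i + 1))).indicator (fun _ => c i) s

lemma point_le {i : ℕ} (hi : i ≤ π.n) : π.point i ≤ T :=
  (π.mono hi).trans_eq π.point_last

lemma exists_mem_Ioc {s : ℝ≥0} (hs : s ∈ Set.Ioc 0 T) :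
    ∃ i < π.n, s ∈ Set.Ioc (π.point i) (π.point (i + 1)) := by
  classical
  have hex : ∃ k, s ≤ π.point k := ⟨π.n, by rw [π.point_last]; exact hs.2⟩
  have h0 : Nat.find hex ≠ 0 := by
    intro h
    have := Nat.find_spec hex
    rw [h, π.point_zero] at this
    exact absurd hs.1 (not_lt.2 this)
  obtain ⟨k, hk⟩ := Nat.exists_eq_succ_of_ne_zero h0
  refine ⟨k, ?_, ?_, ?_⟩
  · have := Nat.find_min' hex (show s ≤ π.point π.n by rw [π.point_last]; exact hs.2)
    omega
  · exact not_le.1 (Nat.find_min hex (by omega))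
  · have := Nat.find_spec hex
    rwa [hk] at this

lemma step_eq {i : ℕ} (hi : i < π.n) {s : ℝ≥0}
    (hs : s ∈ Set.Ioc (π.point i) (π.point (i + 1))) (c : ℕ → ℝ) : π.step c s = c i := by
  rw [step, Finset.sum_eq_single_of_mem i (Finset.mem_range.2 hi), Set.indicator_of_mem hs]
  intro j _ hji
  rw [Set.indicator_of_notMem]
  intro hj
  exact Set.disjoint_left.1 (π.mono.pairwise_disjoint_on_Ioc_succ hji) hj hs

lemma le_mesh {i : ℕ} (hi : i < π.n) : π.point (i + 1) - π.point i ≤ π.mesh :=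
  Finset.le_sup (f := fun i => π.point (i + 1) - π.point i) (Finset.mem_range.2 hi)

lemma measurable_step (c : ℕ → ℝ) : Measurable (π.step c) := by
  unfold step
  exact Finset.measurable_fun_sum _ fun i _ => measurable_const.indicator measurableSet_Ioc

lemma abs_step_le {c : ℕ → ℝ} {C : ℝ} (hc : ∀ i < π.n, |c i| ≤ C) {s : ℝ≥0}
    (hs : s ∈ Set.Ioc 0 T) : |π.step c s| ≤ C := by
  obtain ⟨i, hi, hsi⟩ := π.exists_mem_Ioc hs
  rw [π.step_eq hi hsi]
  exact hc i hi

lemma integral_step_mul (c : ℕ → ℝ) {f : ℝ≥0 → ℝ} (hf : Integrable f (timeMeasure T)) :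
    ∫ s, π.step c s * f s ∂timeMeasure T
      = ∑ i ∈ Finset.range π.n,
          c i * ∫ s in Set.Ioc (π.point i) (π.point (i + 1)), f s ∂lebesgue := by
  have h1 : ∀ i, (fun s => (Set.Ioc (π.point i) (π.point (i + 1))).indicator (fun _ => c i) s * f s)
      = (Set.Ioc (π.point i) (π.point (i + 1))).indicator (fun s => c i * f s) := by
    intro i; ext s
    by_cases h : s ∈ Set.Ioc (π.point i) (π.point (i + 1)) <;> simp [h]
  simp only [step, Finset.sum_mul]
  rw [integral_finsetSum]
  · refine Finset.sum_congr rfl fun i hi => ?_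
    rw [h1, integral_indicator measurableSet_Ioc, timeMeasure,
      Measure.restrict_restrict measurableSet_Ioc, Set.inter_eq_left.2, integral_const_mul]
    exact Set.Ioc_subset_Ioc zero_le (π.point_le (Finset.mem_range.1 hi))
  · intro i _
    rw [h1]
    exact (hf.const_mul _).indicator measurableSet_Ioc

/-- The partition of `[0, T]` into `n + 1` intervals of equal length. -/
def uniform (T : ℝ≥0) (n : ℕ) : TimePartition T where
  n := n + 1
  point i := T * ((min i (n + 1) : ℕ) / (n + 1 : ℕ))
  mono i j hij := by
    dsimp only
    gcongr
  point_zero := by simp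
  point_last := by
    rw [min_self, div_self (by positivity), mul_one]

lemma mesh_uniform_le (T : ℝ≥0) (n : ℕ) : (uniform T n).mesh ≤ T / (n + 1 : ℕ) := by
  refine Finset.sup_le fun i hi => ?_
  have hi' : i < n + 1 := Finset.mem_range.1 hi
  simp only [uniform]
  rw [min_eq_left hi'.le, min_eq_left hi', tsub_le_iff_right]
  apply le_of_eq
  push_cast
  field_simp
  ring

lemma tendsto_mesh_uniform (T : ℝ≥0) :
    Tendsto (fun n => (uniform T n).mesh) atTop (𝓝 0) := by
  have h : Tendsto (fun n : ℕ => T / ((n + 1 : ℕ) : ℝ≥0)) atTop (𝓝 0) := by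
    have := (tendsto_const_div_atTop_nhds_zero_nat (𝕜 := ℝ≥0) T)
    exact this.comp (tendsto_add_atTop_nat 1)
  exact tendsto_of_tendsto_of_tendsto_of_le_of_le tendsto_const_nhds h (fun _ => zero_le)
    (mesh_uniform_le T)

end TimePartition

/-! ### Càdlàg paths -/

/-- A càdlàg path is bounded on the compact interval `[0, T]`. -/
lemma IsCadlagOn.exists_abs_le {T : ℝ≥0} {f : ℝ≥0 → ℝ} (hf : IsCadlagOn T f) :
    ∃ C, ∀ t ≤ T, |f t| ≤ C := by
  have key : ∃ C, ∀ t ∈ Set.Icc 0 T, |f t| ≤ C := by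
    refine isCompact_Icc.induction_on (p := fun s => ∃ C, ∀ t ∈ s, |f t| ≤ C) ⟨0, by simp⟩ ?_ ?_ ?_
    · rintro s t hst ⟨C, hC⟩
      exact ⟨C, fun x hx => hC x (hst hx)⟩
    · rintro s t ⟨C, hC⟩ ⟨D, hD⟩
      refine ⟨max C D, ?_⟩
      rintro x (hx | hx)
      · exact (hC x hx).trans (le_max_left _ _)
      · exact (hD x hx).trans (le_max_right _ _)
    · intro x hx
      obtain ⟨C₁, h₁⟩ : ∃ C, ∀ᶠ t in 𝓝[Set.Iio x ∩ Set.Icc 0 T] x, |f t| ≤ C := by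
        rcases eq_or_ne x 0 with rfl | h0
        · refine ⟨0, ?_⟩
          simp
        · obtain ⟨l, hl⟩ := hf.2 x (pos_iff_ne_zero.2 h0) hx.2
          refine ⟨|l| + 1, ?_⟩
          have := (hl.abs.eventually (gt_mem_nhds (lt_add_one |l|)))
          exact (this.filter_mono (nhdsWithin_mono _ Set.inter_subset_left)).mono fun _ h => h.le
      obtain ⟨C₂, h₂⟩ : ∃ C, ∀ᶠ t in 𝓝[Set.Ici x ∩ Set.Icc 0 T] x, |f t| ≤ C := by
        rcases hx.2.eq_or_lt with rfl | hlt
        · refine ⟨|f x|, ?_⟩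
          filter_upwards [self_mem_nhdsWithin] with t ht
          rw [le_antisymm ht.2.2 ht.1]
        · refine ⟨|f x| + 1, ?_⟩
          have := ((hf.1 x hlt).tendsto.abs.eventually (gt_mem_nhds (lt_add_one |f x|)))
          exact (this.filter_mono (nhdsWithin_mono _ Set.inter_subset_left)).mono fun _ h => h.le
      have hun : Set.Icc 0 T = (Set.Iio x ∩ Set.Icc 0 T) ∪ (Set.Ici x ∩ Set.Icc 0 T) := by
        rw [← Set.union_inter_distrib_right, Set.Iio_union_Ici, Set.univ_inter]
      have h : ∀ᶠ t in 𝓝[Set.Icc 0 T] x, |f t| ≤ max C₁ C₂ := by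
        rw [hun, nhdsWithin_union, eventually_sup]
        exact ⟨h₁.mono fun _ h => h.trans (le_max_left _ _),
          h₂.mono fun _ h => h.trans (le_max_right _ _)⟩
      exact ⟨_, h, max C₁ C₂, fun t ht => ht⟩
  obtain ⟨C, hC⟩ := key
  exact ⟨C, fun t ht => hC t ⟨zero_le, ht⟩⟩

lemma IsCadlagOn.congr {T : ℝ≥0} {f g : ℝ≥0 → ℝ} (hf : IsCadlagOn T f)
    (h : ∀ t ≤ T, g t = f t) : IsCadlagOn T g := by
  refine ⟨fun t ht => ?_, fun t h0 ht => ?_⟩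
  · refine (hf.1 t ht).congr_of_eventuallyEq ?_ (h t ht.le)
    filter_upwards [mem_nhdsWithin_of_mem_nhds (Iio_mem_nhds ht)] with s hs using h s (le_of_lt hs)
  · obtain ⟨l, hl⟩ := hf.2 t h0 ht
    refine ⟨l, hl.congr' ?_⟩
    filter_upwards [self_mem_nhdsWithin] with s hs using (h s (hs.le.trans ht)).symm

lemma IsCadlagOn.add {T : ℝ≥0} {f g : ℝ≥0 → ℝ} (hf : IsCadlagOn T f) (hg : IsCadlagOn T g) :
    IsCadlagOn T fun t => f t + g t := by
  refine ⟨fun t ht => (hf.1 t ht).add (hg.1 t ht), fun t h0 ht => ?_⟩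
  obtain ⟨l, hl⟩ := hf.2 t h0 ht
  obtain ⟨m, hm⟩ := hg.2 t h0 ht
  exact ⟨l + m, hl.add hm⟩

lemma IsCadlagOn.neg {T : ℝ≥0} {f : ℝ≥0 → ℝ} (hf : IsCadlagOn T f) :
    IsCadlagOn T fun t => - f t := by
  refine ⟨fun t ht => (hf.1 t ht).neg, fun t h0 ht => ?_⟩
  obtain ⟨l, hl⟩ := hf.2 t h0 ht
  exact ⟨-l, hl.neg⟩

lemma isCadlagOn_const (T : ℝ≥0) (c : ℝ) : IsCadlagOn T fun _ => c :=
  ⟨fun _ _ => continuousWithinAt_const, fun _ _ _ => ⟨c, tendsto_const_nhds⟩⟩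

/-- Sampling a càdlàg path at the right end points recovers the path, at every time. -/
lemma IsCadlagOn.tendsto_step_right {T : ℝ≥0} {f : ℝ≥0 → ℝ} (hf : IsCadlagOn T f)
    {π : ℕ → TimePartition T} (hπ : Tendsto (fun j => (π j).mesh) atTop (𝓝 0))
    {s : ℝ≥0} (hs : s ∈ Set.Ioc 0 T) :
    Tendsto (fun j => (π j).step (fun i => f ((π j).point (i + 1))) s) atTop (𝓝 (f s)) := by
  choose i hi hsi using fun j => (π j).exists_mem_Ioc hs
  have heq : ∀ j, (π j).step (fun i => f ((π j).point (i + 1))) s = f ((π j).point (i j + 1)) :=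
    fun j => (π j).step_eq (hi j) (hsi j) _
  simp only [heq]
  rcases hs.2.eq_or_lt with rfl | hlt
  · have : ∀ j, (π j).point (i j + 1) = s := fun j =>
      le_antisymm ((π j).point_le (hi j)) (hsi j).2
    simp [this]
  · refine (hf.1 s hlt).tendsto.comp (tendsto_nhdsWithin_iff.2 ⟨?_, .of_forall fun j => (hsi j).2⟩)
    refine tendsto_of_tendsto_of_tendsto_of_le_of_le tendsto_const_nhds
      (by simpa using hπ.const_add s) (fun j => (hsi j).2) fun j => ?_
    have := tsub_le_iff_right.1 ((π j).le_mesh (hi j))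
    calc (π j).point (i j + 1) ≤ (π j).mesh + (π j).point (i j) := this
      _ ≤ s + (π j).mesh := by rw [add_comm]; gcongr; exact (hsi j).1.le

/-- Sampling a path at the left end points recovers its left limits. -/
lemma tendsto_step_left {T : ℝ≥0} {f : ℝ≥0 → ℝ} {s : ℝ≥0} {l : ℝ}
    (hl : Tendsto f (𝓝[Set.Iio s ∩ Set.Icc 0 T] s) (𝓝 l))
    {π : ℕ → TimePartition T} (hπ : Tendsto (fun j => (π j).mesh) atTop (𝓝 0))
    (hs : s ∈ Set.Ioc 0 T) :
    Tendsto (fun j => (π j).step (fun i => f ((π j).point i)) s) atTop (𝓝 l) := by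
  choose i hi hsi using fun j => (π j).exists_mem_Ioc hs
  have heq : ∀ j, (π j).step (fun i => f ((π j).point i)) s = f ((π j).point (i j)) :=
    fun j => (π j).step_eq (hi j) (hsi j) _
  simp only [heq]
  refine hl.comp (tendsto_nhdsWithin_iff.2 ⟨?_, .of_forall fun j =>
    ⟨(hsi j).1, zero_le, (π j).point_le (hi j).le⟩⟩)
  have hlow : Tendsto (fun j => s - (π j).mesh) atTop (𝓝 s) := by
    simpa using (tendsto_const_nhds (x := s)).sub hπ
  refine tendsto_of_tendsto_of_tendsto_of_le_of_le hlow tendsto_const_nhds (fun j => ?_)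
    fun j => (hsi j).1.le
  have := tsub_le_iff_right.1 ((π j).le_mesh (hi j))
  exact tsub_le_iff_left.2 ((hsi j).2.trans this)

/-- A path with left limits has only countably many jumps from the left. -/
lemma IsCadlagOn.countable_leftJumps {T : ℝ≥0} {f : ℝ≥0 → ℝ} (hf : IsCadlagOn T f) :
    {t | t ∈ Set.Ioc 0 T ∧ ¬ Tendsto f (𝓝[<] t) (𝓝 (f t))}.Countable := by
  obtain ⟨d, hd, hdd⟩ := TopologicalSpace.exists_countable_dense ℝ≥0
  refine Set.Countable.mono ?_ (hd.biUnion fun r _ =>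
    (countable_image_gt_image_Iio_within (Set.Ioi r) f).union
      (countable_image_lt_image_Iio_within (Set.Ioi r) f))
  rintro t ⟨ht, hne⟩
  obtain ⟨l, hl⟩ := hf.2 t ht.1 ht.2
  have hlt : l ≠ f t := by rintro rfl; exact hne hl
  have hloc : ∀ p : ℝ≥0 → Prop, (∀ᶠ y in 𝓝[<] t, p y) →
      ∃ r ∈ d, r < t ∧ ∀ y ∈ Set.Ioi r, y < t → p y := by
    intro p hp
    obtain ⟨a, hat, ha⟩ := (mem_nhdsLT_iff_exists_Ioo_subset' ht.1).1 hp
    obtain ⟨r, hrd, hr⟩ := hdd.exists_between hat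
    exact ⟨r, hrd, hr.2, fun y hy hyt => ha ⟨hr.1.trans hy, hyt⟩⟩
  simp only [Set.mem_iUnion]
  rcases lt_or_gt_of_ne hlt with h | h
  · obtain ⟨z, hz1, hz2⟩ := exists_between h
    obtain ⟨r, hrd, hrt, hr⟩ := hloc _ (hl.eventually (gt_mem_nhds hz1))
    exact ⟨r, hrd, .inr ⟨hrt, z, hz2, fun y hy hyt => (hr y hy hyt).le⟩⟩
  · obtain ⟨z, hz1, hz2⟩ := exists_between h
    obtain ⟨r, hrd, hrt, hr⟩ := hloc _ (hl.eventually (lt_mem_nhds hz2))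
    exact ⟨r, hrd, .inl ⟨hrt, z, hz1, fun y hy hyt => (hr y hy hyt).le⟩⟩

lemma IsCadlagOn.ae_tendsto_left {T : ℝ≥0} {f : ℝ≥0 → ℝ} (hf : IsCadlagOn T f) :
    ∀ᵐ t ∂timeMeasure T, Tendsto f (𝓝[<] t) (𝓝 (f t)) := by
  filter_upwards [ae_timeMeasure_mem T,
    compl_mem_ae_iff.2 (hf.countable_leftJumps.measure_zero (timeMeasure T))] with t ht h
  by_contra hne
  exact h ⟨ht, hne⟩

/-! ### Stochastic integrals of absolutely continuous integrands -/

/-- Summation by parts. -/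
lemma itoSum_eq {Ω : Type*} {T : ℝ≥0} (π : TimePartition T) (K Y : ℝ≥0 → Ω → ℝ) (ω : Ω) :
    itoSum K Y π ω = K T ω * Y T ω - K 0 ω * Y 0 ω
      - ∑ i ∈ Finset.range π.n,
          Y (π.point (i + 1)) ω * (K (π.point (i + 1)) ω - K (π.point i) ω) := by
  have h := Finset.sum_range_sub (fun i => K (π.point i) ω * Y (π.point i) ω) π.n
  rw [π.point_zero, π.point_last] at h
  rw [← h, itoSum, ← Finset.sum_sub_distrib]
  exact Finset.sum_congr rfl fun i _ => by ring

lemma setIntegral_Ioc_sub {f : ℝ≥0 → ℝ} {T a b : ℝ≥0} (hf : Integrable f (timeMeasure T))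
    (hab : a ≤ b) (hb : b ≤ T) :
    ∫ s in Set.Ioc a b, f s ∂lebesgue
      = (∫ s in Set.Ioc 0 b, f s ∂lebesgue) - ∫ s in Set.Ioc 0 a, f s ∂lebesgue := by
  have h1 : IntegrableOn f (Set.Ioc 0 T) lebesgue := hf
  rw [← Set.Ioc_union_Ioc_eq_Ioc (zero_le (a := a)) hab, setIntegral_union
    (Set.Ioc_disjoint_Ioc_of_le le_rfl) measurableSet_Ioc
    (h1.mono_set (Set.Ioc_subset_Ioc_right (hab.trans hb)))
    (h1.mono_set (Set.Ioc_subset_Ioc zero_le hb))]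
  ring

/-- Along refining partitions, the left-point sums of an absolutely continuous integrand against a
càdlàg path converge to the value that integration by parts suggests. -/
lemma tendsto_itoSum {Ω : Type*} {T : ℝ≥0} {K Y μ : ℝ≥0 → Ω → ℝ} {ω : Ω}
    (hY : IsCadlagOn T fun t => Y t ω)
    (hμ : Integrable (fun s => μ s ω) (timeMeasure T))
    (hK : ∀ t ≤ T, K t ω = timeInt μ t ω)
    {π : ℕ → TimePartition T} (hπ : Tendsto (fun j => (π j).mesh) atTop (𝓝 0)) :
    Tendsto (fun j => itoSum K Y (π j) ω) atTop
      (𝓝 (K T ω * Y T ω - ∫ s, Y s ω * μ s ω ∂timeMeasure T)) := by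
  have h0 : K 0 ω = 0 := by rw [hK 0 zero_le, timeInt_eq]; simp
  have heq : ∀ j, itoSum K Y (π j) ω = K T ω * Y T ω
      - ∫ s, (π j).step (fun i => Y ((π j).point (i + 1)) ω) s * μ s ω ∂timeMeasure T := by
    intro j
    rw [itoSum_eq, h0, (π j).integral_step_mul _ hμ, zero_mul, sub_zero]
    congr 1
    refine Finset.sum_congr rfl fun i hi => ?_
    have hi' := Finset.mem_range.1 hi
    rw [setIntegral_Ioc_sub hμ ((π j).mono i.le_succ) ((π j).point_le hi'),
      hK _ ((π j).point_le hi'), hK _ ((π j).point_le hi'.le), timeInt_eq, timeInt_eq]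
  simp only [heq]
  refine tendsto_const_nhds.sub ?_
  obtain ⟨C, hC⟩ := hY.exists_abs_le
  refine tendsto_integral_of_dominated_convergence (fun s => C * |μ s ω|) (fun j => ?_)
    (hμ.abs.const_mul C) (fun j => ?_) ?_
  · exact ((π j).measurable_step _).aestronglyMeasurable.mul hμ.aestronglyMeasurable
  · filter_upwards [ae_timeMeasure_mem T] with s hs
    rw [Real.norm_eq_abs, abs_mul]
    gcongr
    exact (π j).abs_step_le (fun i hi => hC _ ((π j).point_le hi)) hs
  · filter_upwards [ae_timeMeasure_mem T] with s hs
    exact (hY.tendsto_step_right hπ hs).mul_const _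

/-- The stochastic integral of an absolutely continuous integrand exists for every integrator with
càdlàg paths, and is given by integration by parts. -/
lemma isStochasticIntegral_of_cadlag {Ω : Type*} [MeasurableSpace Ω] {P : Measure Ω}
    [IsProbabilityMeasure P] {T : ℝ≥0} {K Y μ : ℝ≥0 → Ω → ℝ}
    (hYm : ∀ t ≤ T, AEStronglyMeasurable (Y t) P)
    (hKm : ∀ t ≤ T, AEStronglyMeasurable (K t) P)
    (hY : ∀ᵐ ω ∂P, IsCadlagOn T fun t => Y t ω)
    (hμ : ∀ᵐ ω ∂P, Integrable (fun s => μ s ω) (timeMeasure T))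
    (hK : ∀ᵐ ω ∂P, ∀ t ≤ T, K t ω = timeInt μ t ω) :
    IsStochasticIntegral P T K Y
      fun ω => K T ω * Y T ω - ∫ s, Y s ω * μ s ω ∂timeMeasure T := by
  have hm : ∀ π : TimePartition T, AEStronglyMeasurable (itoSum K Y π) P := by
    intro π
    unfold itoSum
    refine Finset.aestronglyMeasurable_fun_sum _ fun i hi => ?_
    have hi' := Finset.mem_range.1 hi
    exact (hKm _ (π.point_le hi'.le)).mul
      ((hYm _ (π.point_le hi')).sub (hYm _ (π.point_le hi'.le)))
  have hlim : ∀ π : ℕ → TimePartition T, Tendsto (fun j => (π j).mesh) atTop (𝓝 0) →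
      ∀ᵐ ω ∂P, Tendsto (fun j => itoSum K Y (π j) ω) atTop
        (𝓝 (K T ω * Y T ω - ∫ s, Y s ω * μ s ω ∂timeMeasure T)) := by
    intro π hπ
    filter_upwards [hY, hμ, hK] with ω h1 h2 h3 using tendsto_itoSum h1 h2 h3 hπ
  refine ⟨?_, fun π hπ => tendstoInMeasure_of_tendsto_ae (fun j => hm _) (hlim π hπ)⟩
  exact aestronglyMeasurable_of_tendsto_ae atTop (fun j => hm (TimePartition.uniform T j))
    (hlim _ (TimePartition.tendsto_mesh_uniform T))

lemma IsStochasticIntegral.ae_eq {Ω : Type*} [MeasurableSpace Ω] {P : Measure Ω} {T : ℝ≥0}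
    {K Y : ℝ≥0 → Ω → ℝ} {I J : Ω → ℝ} (hI : IsStochasticIntegral P T K Y I)
    (hJ : IsStochasticIntegral P T K Y J) : I =ᵐ[P] J :=
  tendstoInMeasure_ae_unique (hI.2 _ (TimePartition.tendsto_mesh_uniform T))
    (hJ.2 _ (TimePartition.tendsto_mesh_uniform T))

/-! ### The variation of a right-continuous process -/

namespace TimePartition

variable {T : ℝ≥0} (π : TimePartition T)

/-- The first partition point that is at least `s`, for `s ≤ T`; beyond `T` the value is irrelevant. -/
def roundUp (s : ℝ≥0) : ℝ≥0 := π.point (sInf {k | s ≤ π.point k})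

lemma roundUp_set_nonempty {s : ℝ≥0} (hs : s ≤ T) : {k | s ≤ π.point k}.Nonempty :=
  ⟨π.n, by rwa [Set.mem_ofPred_eq, π.point_last]⟩

lemma le_roundUp {s : ℝ≥0} (hs : s ≤ T) : s ≤ π.roundUp s :=
  Nat.sInf_mem (π.roundUp_set_nonempty hs)

lemma sInf_le_n {s : ℝ≥0} (hs : s ≤ T) : sInf {k | s ≤ π.point k} ≤ π.n :=
  Nat.sInf_le (show s ≤ π.point π.n by rwa [π.point_last])

lemma monotoneOn_roundUp : MonotoneOn π.roundUp (Set.Icc 0 T) := by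
  intro s _ t ht hst
  refine π.mono (Nat.sInf_le ?_)
  exact hst.trans (π.le_roundUp ht.2)

lemma roundUp_le_add_mesh {s : ℝ≥0} (hs : s ≤ T) : π.roundUp s ≤ s + π.mesh := by
  rcases h : sInf {k | s ≤ π.point k} with _ | k
  · simp [roundUp, h, π.point_zero]
  · have hk : ¬ s ≤ π.point k := fun hk => by
      have := Nat.sInf_le (s := {k | s ≤ π.point k}) hk
      omega
    have hn := π.sInf_le_n hs
    have := tsub_le_iff_right.1 (π.le_mesh (i := k) (by omega))
    rw [roundUp, h]
    calc π.point (k + 1) ≤ π.mesh + π.point k := this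
      _ ≤ s + π.mesh := by rw [add_comm]; gcongr; exact (not_le.1 hk).le

end TimePartition

/-- The variation of a right-continuous path is exhausted by uniform partitions. -/
lemma eVariationOn_Icc_eq_iSup {T : ℝ≥0} {f : ℝ≥0 → ℝ}
    (hf : ∀ t < T, ContinuousWithinAt f (Set.Ici t) t) :
    eVariationOn f (Set.Icc 0 T) = ⨆ n : ℕ, ∑ i ∈ Finset.range (TimePartition.uniform T n).n,
      edist (f ((TimePartition.uniform T n).point i))
        (f ((TimePartition.uniform T n).point (i + 1))) := by
  set π := TimePartition.uniform T
  have hsum : ∀ n, eVariationOn f ((π n).point '' Set.Iic (π n).n)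
      = ∑ i ∈ Finset.range (π n).n, edist (f ((π n).point i)) (f ((π n).point (i + 1))) :=
    fun n => eVariationOn.image_range_of_monotone f (π n).mono _
  simp only [← hsum]
  apply le_antisymm
  · refine le_of_forall_lt fun v hv => ?_
    have hlim : ∀ s ∈ Set.Icc 0 T, Tendsto (fun n => (f ∘ (π n).roundUp) s) atTop (𝓝 (f s)) := by
      intro s hs
      have hle : ∀ n, (π n).roundUp s ≤ T := fun n =>
        (π n).point_le ((π n).sInf_le_n hs.2)
      rcases hs.2.eq_or_lt with rfl | hlt
      · have : ∀ n, (π n).roundUp s = s := fun n =>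
          le_antisymm (hle n) ((π n).le_roundUp le_rfl)
        simp [this]
      · refine (hf s hlt).tendsto.comp (tendsto_nhdsWithin_iff.2
          ⟨?_, .of_forall fun n => (π n).le_roundUp hs.2⟩)
        exact tendsto_of_tendsto_of_tendsto_of_le_of_le tendsto_const_nhds
          (by simpa using (TimePartition.tendsto_mesh_uniform T).const_add s)
          (fun n => (π n).le_roundUp hs.2) fun n => (π n).roundUp_le_add_mesh hs.2
    obtain ⟨n, hn⟩ := (eVariationOn.lowerSemicontinuous_aux hlim hv).exists
    refine hn.trans_le ((eVariationOn.comp_le_of_monotoneOn f _ (π n).monotoneOn_roundUp ?_).trans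
      (le_iSup (fun n => eVariationOn f ((π n).point '' Set.Iic (π n).n)) n))
    exact fun s hs => ⟨_, (π n).sInf_le_n hs.2, rfl⟩
  · refine iSup_le fun n => eVariationOn.mono f ?_
    rintro _ ⟨i, hi, rfl⟩
    exact ⟨zero_le, (π n).point_le hi⟩

lemma measurable_eVariationOn {Ω : Type*} [MeasurableSpace Ω] {T : ℝ≥0} {X : ℝ≥0 → Ω → ℝ}
    (hX : ∀ t, Measurable (X t))
    (hr : ∀ ω, ∀ t < T, ContinuousWithinAt (fun t => X t ω) (Set.Ici t) t) :
    Measurable fun ω => eVariationOn (fun t => X t ω) (Set.Icc 0 T) := by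
  simp only [fun ω => eVariationOn_Icc_eq_iSup (hr ω)]
  exact Measurable.iSup fun n => Finset.measurable_fun_sum _ fun i _ => (hX _).edist (hX _)

/-! ### Lebesgue–Stieltjes integrals -/

/-- The path `a` is right-continuous on `[0, T)` and of bounded variation on `[0, T]`. -/
structure IsDriftPath (T : ℝ≥0) (a : ℝ≥0 → ℝ) : Prop where
  rightCont : ∀ t < T, ContinuousWithinAt a (Set.Ici t) t
  bv : BoundedVariationOn a (Set.Icc 0 T)

namespace IsDriftPath

variable {T : ℝ≥0} {a : ℝ≥0 → ℝ} (h : IsDriftPath T a)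
include h

lemma stop_bv : BoundedVariationOn (fun t => a (min t T)) Set.univ :=
  ne_top_of_le_ne_top h.bv (eVariationOn.comp_le_of_monotoneOn a (fun t => min t T)
    (fun _ _ _ _ hst => min_le_min_right T hst) fun _ _ => ⟨zero_le, min_le_right _ _⟩)

lemma stop_rightCont (t : ℝ≥0) :
    ContinuousWithinAt (fun t => a (min t T)) (Set.Ici t) t := by
  rcases lt_or_ge t T with ht | ht
  · refine (h.rightCont t ht).congr_of_eventuallyEq ?_ (by rw [min_eq_left ht.le])
    filter_upwards [mem_nhdsWithin_of_mem_nhds (Iio_mem_nhds ht)] with s hs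
    rw [min_eq_left (le_of_lt hs)]
  · refine (continuousWithinAt_const (b := a T)).congr (fun s hs => ?_) ?_
    · rw [min_eq_right (ht.trans hs)]
    · rw [min_eq_right ht]

lemma stop_rightLim : Function.rightLim (fun t => a (min t T)) = fun t => a (min t T) :=
  funext fun t => (h.stop_rightCont t).rightLim_eq

omit h in
/-- The variation of `a` on `[0, t]`, as a Stieltjes function. -/
def varFun (h : IsDriftPath T a) : StieltjesFunction ℝ≥0 where
  toFun := variationOnFromTo (fun t => a (min t T)) Set.univ 0
  mono' := monotoneOn_univ.1
    (variationOnFromTo.monotoneOn h.stop_bv.locallyBoundedVariationOn (Set.mem_univ _))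
  right_continuous' t := by
    have := h.stop_bv.continuousWithinAt_variationOnFromTo_rightLim_Ici (a := 0) (x := t)
    rwa [h.stop_rightLim] at this

omit h in
/-- The difference of the variation of `a` on `[0, t]` and of `a t`, as a Stieltjes function. -/
def varSubFun (h : IsDriftPath T a) : StieltjesFunction ℝ≥0 where
  toFun := variationOnFromTo (fun t => a (min t T)) Set.univ 0 - fun t => a (min t T)
  mono' := monotoneOn_univ.1
    (variationOnFromTo.sub_self_monotoneOn h.stop_bv.locallyBoundedVariationOn (Set.mem_univ _))
  right_continuous' t := (h.varFun.right_continuous t).sub (h.stop_rightCont t)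

lemma varFun_apply {t : ℝ≥0} (ht : t ≤ T) :
    h.varFun t = (eVariationOn a (Set.Icc 0 t)).toReal := by
  change variationOnFromTo _ _ _ _ = _
  rw [variationOnFromTo.eq_of_le _ _ zero_le, Set.univ_inter]
  congr 1
  exact eVariationOn.congr fun s hs => by simp [min_eq_left (hs.2.trans ht)]

lemma varSubFun_apply {t : ℝ≥0} (ht : t ≤ T) : h.varSubFun t = h.varFun t - a t := by
  change h.varFun t - a (min t T) = _
  rw [min_eq_left ht]

omit h in
/-- The measure on `(0, T]` with distribution function `varFun`. -/
def varMeasure (h : IsDriftPath T a) : Measure ℝ≥0 := h.varFun.measure.restrict (Set.Ioc 0 T)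

omit h in
/-- The measure on `(0, T]` with distribution function `varSubFun`. -/
def varSubMeasure (h : IsDriftPath T a) : Measure ℝ≥0 :=
  h.varSubFun.measure.restrict (Set.Ioc 0 T)

omit h in
lemma restrict_measure_Ioc (F : StieltjesFunction ℝ≥0) (u v : ℝ≥0) :
    F.measure.restrict (Set.Ioc 0 T) (Set.Ioc u v) = ENNReal.ofReal (F (min v T) - F u) := by
  rw [Measure.restrict_apply measurableSet_Ioc, Set.Ioc_inter_Ioc, StieltjesFunction.measure_Ioc]
  simp

omit h in
lemma restrict_measure_univ (F : StieltjesFunction ℝ≥0) :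
    F.measure.restrict (Set.Ioc 0 T) Set.univ = ENNReal.ofReal (F T - F 0) := by
  rw [Measure.restrict_apply_univ, StieltjesFunction.measure_Ioc]

instance (h : IsDriftPath T a) : IsFiniteMeasure h.varMeasure :=
  ⟨by rw [varMeasure, restrict_measure_univ]; exact ENNReal.ofReal_lt_top⟩

instance (h : IsDriftPath T a) : IsFiniteMeasure h.varSubMeasure :=
  ⟨by rw [varSubMeasure, restrict_measure_univ]; exact ENNReal.ofReal_lt_top⟩

lemma varFun_zero : h.varFun 0 = 0 := variationOnFromTo.self _ _ _

lemma varMeasure_univ : h.varMeasure Set.univ = eVariationOn a (Set.Icc 0 T) := by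
  rw [varMeasure, restrict_measure_univ, h.varFun_apply le_rfl, h.varFun_zero, sub_zero,
    ENNReal.ofReal_toReal h.bv]

lemma varSubMeasure_univ_le :
    h.varSubMeasure Set.univ ≤ 2 * eVariationOn a (Set.Icc 0 T) := by
  rw [varSubMeasure, restrict_measure_univ, h.varSubFun_apply le_rfl, h.varSubFun_apply zero_le,
    h.varFun_zero, h.varFun_apply le_rfl]
  have h1 : a 0 - a T ≤ (eVariationOn a (Set.Icc 0 T)).toReal :=
    h.bv.sub_le ⟨le_rfl, zero_le⟩ ⟨zero_le, le_rfl⟩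
  rw [← ENNReal.ofReal_toReal h.bv, ← ENNReal.ofReal_ofNat, ← ENNReal.ofReal_mul (by norm_num)]
  refine ENNReal.ofReal_le_ofReal ?_
  rw [ENNReal.toReal_ofReal ENNReal.toReal_nonneg]
  linarith

/-- The Jordan-type decomposition `da = dV - d(V - a)`, where `V` is the variation of `a`. -/
lemma vectorMeasure_restrict :
    h.stop_bv.vectorMeasure.restrict (Set.Ioc 0 T)
      = h.varMeasure.toSignedMeasure - h.varSubMeasure.toSignedMeasure := by
  have key : ∀ u v, u ≤ v → h.stop_bv.vectorMeasure (Set.Ioc u v)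
      = (h.varFun v - h.varFun u) - (h.varSubFun v - h.varSubFun u) := by
    intro u v huv
    rw [BoundedVariationOn.vectorMeasure_Ioc _ huv, h.stop_rightLim]
    change _ = _ - ((h.varFun v - _) - (h.varFun u - _))
    ring
  refine VectorMeasure.ext_of_generateFrom _ ?_
    ((borel_eq_generateFrom_Ioc ℝ≥0).symm ▸ BorelSpace.measurable_eq) (isPiSystem_Ioc id id) ?_
  · rintro _ ⟨u, v, huv, rfl⟩
    rw [VectorMeasure.restrict_apply _ measurableSet_Ioc measurableSet_Ioc,
      sub_apply, Measure.toSignedMeasure_apply_measurable measurableSet_Ioc,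
      Measure.toSignedMeasure_apply_measurable measurableSet_Ioc, measureReal_def, measureReal_def,
      varMeasure, varSubMeasure, restrict_measure_Ioc, restrict_measure_Ioc, Set.Ioc_inter_Ioc]
    simp only [id, zero_le, sup_of_le_left]
    rcases le_total u (min v T) with hle | hle
    · rw [key _ _ hle, ENNReal.toReal_ofReal (sub_nonneg.2 (h.varFun.mono hle)),
        ENNReal.toReal_ofReal (sub_nonneg.2 (h.varSubFun.mono hle))]
    · rw [Set.Ioc_eq_empty_of_le hle, VectorMeasure.empty,
        ENNReal.ofReal_of_nonpos (sub_nonpos.2 (h.varFun.mono hle)),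
        ENNReal.ofReal_of_nonpos (sub_nonpos.2 (h.varSubFun.mono hle))]
      simp
  · rw [VectorMeasure.restrict_apply _ measurableSet_Ioc MeasurableSet.univ,
      sub_apply, Measure.toSignedMeasure_apply_measurable MeasurableSet.univ,
      Measure.toSignedMeasure_apply_measurable MeasurableSet.univ, measureReal_def, measureReal_def,
      varMeasure, varSubMeasure, restrict_measure_univ, restrict_measure_univ, Set.univ_inter,
      key _ _ zero_le, ENNReal.toReal_ofReal (sub_nonneg.2 (h.varFun.mono zero_le)),
      ENNReal.toReal_ofReal (sub_nonneg.2 (h.varSubFun.mono zero_le))]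

lemma lsIntegral_eq {f : ℝ≥0 → ℝ} (hf : Integrable f h.varMeasure)
    (hf' : Integrable f h.varSubMeasure) :
    lsIntegral T f a = ∫ t, f t ∂h.varMeasure - ∫ t, f t ∂h.varSubMeasure := by
  have hflip : ContinuousLinearMap.lsmul ℝ ℝ (E := ℝ)
      = (ContinuousLinearMap.lsmul ℝ ℝ (E := ℝ)).flip := by
    ext; simp
  rw [lsIntegral, dif_pos h.stop_bv, h.vectorMeasure_restrict, hflip,
    VectorMeasure.integral_sub_vectorMeasure, VectorMeasure.integral_toSignedMeasure,
    VectorMeasure.integral_toSignedMeasure]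
  · rwa [VectorMeasure.Integrable, Measure.variation_toSignedMeasure]
  · rwa [VectorMeasure.Integrable, Measure.variation_toSignedMeasure]

lemma lsIntegral_indicator_Ioi {t : ℝ≥0} (ht : t ≤ T) (c : ℝ) :
    lsIntegral T ((Set.Ioi t).indicator fun _ => c) a = c * (a T - a t) := by
  have hmeas : ∀ F : StieltjesFunction ℝ≥0,
      (F.measure.restrict (Set.Ioc 0 T)).real (Set.Ioi t) = F T - F t := by
    intro F
    have : Set.Ioi t ∩ Set.Ioc 0 T = Set.Ioc t T := by
      ext s
      simp only [Set.mem_inter_iff, Set.mem_Ioi, Set.mem_Ioc]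
      exact ⟨fun hs => ⟨hs.1, hs.2.2⟩, fun hs => ⟨hs.1, zero_le.trans_lt hs.1, hs.2⟩⟩
    rw [measureReal_def, Measure.restrict_apply measurableSet_Ioi, this,
      StieltjesFunction.measure_Ioc, ENNReal.toReal_ofReal (sub_nonneg.2 (F.mono ht))]
  rw [h.lsIntegral_eq ((integrable_const c).indicator measurableSet_Ioi)
    ((integrable_const c).indicator measurableSet_Ioi),
    integral_indicator_const _ measurableSet_Ioi, integral_indicator_const _ measurableSet_Ioi,
    varMeasure, varSubMeasure, hmeas, hmeas, h.varSubFun_apply le_rfl, h.varSubFun_apply ht]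
  simp only [smul_eq_mul]
  ring

end IsDriftPath

/-! ### Measurability in `ω` of Lebesgue–Stieltjes integrals -/

/-- A kernel of finite measures is s-finite even if the masses are unbounded: it is cut into pieces
according to the integer part of the mass. -/
lemma isSFiniteKernel_of_isFiniteMeasure {α β : Type*} {_ : MeasurableSpace α}
    {_ : MeasurableSpace β} (κ : Kernel α β) (hκ : ∀ a, IsFiniteMeasure (κ a)) :
    IsSFiniteKernel κ := by
  classical
  let s : ℕ → Set α := fun n => {a | ⌊(κ a Set.univ).toReal⌋₊ = n}
  have hs : ∀ n, MeasurableSet (s n) := fun n =>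
    (Nat.measurable_floor.comp (κ.measurable_coe MeasurableSet.univ).ennreal_toReal)
      (measurableSet_singleton n)
  let κs : ℕ → Kernel α β := fun n => Kernel.piecewise (hs n) κ 0
  have hfin : ∀ n, IsFiniteKernel (κs n) := fun n => by
    refine ⟨⟨ENNReal.ofReal (n + 1), ENNReal.ofReal_lt_top, fun a => ?_⟩⟩
    rw [Kernel.piecewise_apply]
    split_ifs with h
    · rw [← ENNReal.ofReal_toReal (measure_ne_top (κ a) Set.univ)]
      refine ENNReal.ofReal_le_ofReal ?_
      have h' : ⌊(κ a Set.univ).toReal⌋₊ = n := h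
      rw [← h']
      exact (Nat.lt_floor_add_one _).le
    · simp
  have hsum : κ = Kernel.sum κs := by
    ext a t ht
    rw [Kernel.sum_apply' _ _ ht, tsum_eq_single ⌊(κ a Set.univ).toReal⌋₊]
    · rw [Kernel.piecewise_apply, if_pos (show a ∈ s _ from rfl)]
    · intro n hn
      rw [Kernel.piecewise_apply, if_neg (show a ∉ s n from fun h => hn h.symm)]
      simp
  rw [hsum]
  have : ∀ n, IsSFiniteKernel (κs n) := fun n => have := hfin n; inferInstance
  exact Kernel.isSFiniteKernel_sum

/-- A process with square-integrable supremum is integrable against a random measure with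
square-integrable mass. The supremum may fail to be measurable, so that its expectation is a lower
integral; this is why the estimate goes through the measurable function `ω ↦ ∫ |K| dκ(ω)`. -/
lemma integrable_integral_kernel {Ω : Type*} [MeasurableSpace Ω] {P : Measure Ω} {T : ℝ≥0}
    {κ : Ω → Measure ℝ≥0} [∀ ω, IsFiniteMeasure (κ ω)] (hκ : Measurable κ)
    (hsupp : ∀ ω, ∀ᵐ t ∂κ ω, t ∈ Set.Ioc 0 T)
    (hmass : ∫⁻ ω, (κ ω Set.univ) ^ 2 ∂P < ⊤)
    {K : ℝ≥0 → Ω → ℝ} (hK : Measurable fun z : Ω × ℝ≥0 => K z.2 z.1)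
    (hK2 : ∫⁻ ω, (⨆ t ∈ Set.Icc (0 : ℝ≥0) T, ‖K t ω‖ₑ ^ 2) ∂P < ⊤) :
    (∀ᵐ ω ∂P, Integrable (fun t => K t ω) (κ ω)) ∧
      Integrable (fun ω => ∫ t, K t ω ∂κ ω) P := by
  let κ' : Kernel Ω ℝ≥0 := ⟨κ, hκ⟩
  have : IsSFiniteKernel κ' := isSFiniteKernel_of_isFiniteMeasure κ' fun ω => inferInstanceAs
    (IsFiniteMeasure (κ ω))
  have hm : Measurable fun ω => ∫⁻ t, ‖K t ω‖ₑ ∂κ ω :=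
    Measurable.lintegral_kernel_prod_right (κ := κ') (f := fun ω t => ‖K t ω‖ₑ) hK.enorm
  have hle : ∀ ω, ∫⁻ t, ‖K t ω‖ₑ ∂κ ω
      ≤ (⨆ t ∈ Set.Icc (0 : ℝ≥0) T, ‖K t ω‖ₑ ^ 2) + (κ ω Set.univ) ^ 2 := by
    intro ω
    set G := ⨆ t ∈ Set.Icc (0 : ℝ≥0) T, ‖K t ω‖ₑ ^ 2
    have hG : G = (G ^ (2⁻¹ : ℝ)) ^ 2 := by
      rw [← ENNReal.rpow_natCast, ← ENNReal.rpow_mul]; norm_num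
    have h1 : ∫⁻ t, ‖K t ω‖ₑ ∂κ ω ≤ G ^ (2⁻¹ : ℝ) * κ ω Set.univ := by
      rw [← lintegral_const]
      refine lintegral_mono_ae ?_
      filter_upwards [hsupp ω] with t ht
      rw [ENNReal.le_rpow_inv_iff (by norm_num)]
      have : ‖K t ω‖ₑ ^ 2 ≤ G :=
        le_iSup₂ (f := fun t (_ : t ∈ Set.Icc (0 : ℝ≥0) T) => ‖K t ω‖ₑ ^ 2) t ⟨ht.1.le, ht.2⟩
      exact_mod_cast this
    refine h1.trans ?_
    set x := G ^ (2⁻¹ : ℝ)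
    set y := κ ω Set.univ
    rw [hG]
    rcases le_total x y with h | h
    · calc x * y ≤ y * y := by gcongr
        _ = y ^ 2 := (sq y).symm
        _ ≤ _ := le_add_self
    · calc x * y ≤ x * x := by gcongr
        _ = x ^ 2 := (sq x).symm
        _ ≤ _ := le_self_add
  have hfin : ∫⁻ ω, ∫⁻ t, ‖K t ω‖ₑ ∂κ ω ∂P < ⊤ := by
    refine (lintegral_mono hle).trans_lt ?_
    rw [lintegral_add_right _
      (((Measure.measurable_coe MeasurableSet.univ).fun_comp hκ).pow_const 2)]
    exact ENNReal.add_lt_top.2 ⟨hK2, hmass⟩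
  have hKω : ∀ ω, Measurable fun t => K t ω := fun ω => hK.comp measurable_prodMk_left
  refine ⟨?_, ?_, ?_⟩
  · filter_upwards [ae_lt_top hm hfin.ne] with ω hω using ⟨(hKω ω).aestronglyMeasurable, hω⟩
  · exact (StronglyMeasurable.integral_kernel_prod_right (κ := κ') (f := fun ω t => K t ω)
      hK.stronglyMeasurable).aestronglyMeasurable
  · exact (lintegral_mono fun ω => enorm_integral_le_lintegral_enorm _).trans_lt hfin

/-- The process `A` has measurable marginals, right-continuous paths of bounded variation on
`[0, T]`, and square-integrable total variation. -/
structure IsDrift {Ω : Type*} [MeasurableSpace Ω] (P : Measure Ω) (T : ℝ≥0)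
    (A : ℝ≥0 → Ω → ℝ) : Prop where
  measurable : ∀ t, Measurable (A t)
  path : ∀ ω, IsDriftPath T fun t => A t ω
  sq : ∫⁻ ω, (eVariationOn (fun t => A t ω) (Set.Icc 0 T)) ^ 2 ∂P < ⊤

namespace IsDrift

variable {Ω : Type*} [MeasurableSpace Ω] {P : Measure Ω} {T : ℝ≥0} {A : ℝ≥0 → Ω → ℝ}

lemma measurable_varFun (h : IsDrift P T A) {t : ℝ≥0} (ht : t ≤ T) :
    Measurable fun ω => (h.path ω).varFun t := by
  simp only [fun ω => (h.path ω).varFun_apply ht]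
  exact (measurable_eVariationOn h.measurable
    fun ω s hs => (h.path ω).rightCont s (hs.trans_le ht)).ennreal_toReal

lemma measurable_varSubFun (h : IsDrift P T A) {t : ℝ≥0} (ht : t ≤ T) :
    Measurable fun ω => (h.path ω).varSubFun t := by
  simp only [fun ω => (h.path ω).varSubFun_apply ht]
  exact (h.measurable_varFun ht).sub (h.measurable t)

omit [MeasurableSpace Ω] in
lemma measurable_restrict_measure [MeasurableSpace Ω] {F : Ω → StieltjesFunction ℝ≥0}
    (hF : ∀ t ≤ T, Measurable fun ω => F ω t) :
    Measurable fun ω => (F ω).measure.restrict (Set.Ioc 0 T) := by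
  have : ∀ ω, IsFiniteMeasure ((F ω).measure.restrict (Set.Ioc 0 T)) := fun ω =>
    ⟨by rw [IsDriftPath.restrict_measure_univ]; exact ENNReal.ofReal_lt_top⟩
  refine Measurable.measure_of_isPiSystem
    ((borel_eq_generateFrom_Ioc ℝ≥0).symm ▸ BorelSpace.measurable_eq) (isPiSystem_Ioc id id) ?_ ?_
  · rintro _ ⟨u, v, huv, rfl⟩
    simp only [id, IsDriftPath.restrict_measure_Ioc]
    rcases le_total u T with hu | hu
    · exact ((hF _ (min_le_right _ _)).sub (hF u hu)).ennreal_ofReal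
    · have : ∀ ω, ENNReal.ofReal (F ω (min v T) - F ω u) = 0 := fun ω =>
        ENNReal.ofReal_of_nonpos (sub_nonpos.2 ((F ω).mono ((min_le_right _ _).trans hu)))
      simp only [this, measurable_const]
  · simp only [IsDriftPath.restrict_measure_univ]
    exact ((hF T le_rfl).sub (hF 0 zero_le)).ennreal_ofReal

lemma integrable_varMeasure (h : IsDrift P T A) {K : ℝ≥0 → Ω → ℝ}
    (hK : Measurable fun z : Ω × ℝ≥0 => K z.2 z.1)
    (hK2 : ∫⁻ ω, (⨆ t ∈ Set.Icc (0 : ℝ≥0) T, ‖K t ω‖ₑ ^ 2) ∂P < ⊤) :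
    (∀ᵐ ω ∂P, Integrable (fun t => K t ω) (h.path ω).varMeasure) ∧
      Integrable (fun ω => ∫ t, K t ω ∂(h.path ω).varMeasure) P := by
  refine integrable_integral_kernel (T := T) (κ := fun ω => (h.path ω).varMeasure)
    (measurable_restrict_measure fun t ht => h.measurable_varFun ht)
    (fun ω => ae_restrict_mem measurableSet_Ioc) ?_ hK hK2
  simpa only [IsDriftPath.varMeasure_univ] using h.sq

lemma integrable_varSubMeasure (h : IsDrift P T A) {K : ℝ≥0 → Ω → ℝ}
    (hK : Measurable fun z : Ω × ℝ≥0 => K z.2 z.1)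
    (hK2 : ∫⁻ ω, (⨆ t ∈ Set.Icc (0 : ℝ≥0) T, ‖K t ω‖ₑ ^ 2) ∂P < ⊤) :
    (∀ᵐ ω ∂P, Integrable (fun t => K t ω) (h.path ω).varSubMeasure) ∧
      Integrable (fun ω => ∫ t, K t ω ∂(h.path ω).varSubMeasure) P := by
  refine integrable_integral_kernel (T := T) (κ := fun ω => (h.path ω).varSubMeasure)
    (measurable_restrict_measure fun t ht => h.measurable_varSubFun ht)
    (fun ω => ae_restrict_mem measurableSet_Ioc) ?_ hK hK2
  calc ∫⁻ ω, ((h.path ω).varSubMeasure Set.univ) ^ 2 ∂P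
      ≤ ∫⁻ ω, 4 * (eVariationOn (fun t => A t ω) (Set.Icc 0 T)) ^ 2 ∂P := by
        refine lintegral_mono fun ω => ?_
        calc ((h.path ω).varSubMeasure Set.univ) ^ 2
            ≤ (2 * eVariationOn (fun t => A t ω) (Set.Icc 0 T)) ^ 2 := by
              gcongr; exact (h.path ω).varSubMeasure_univ_le
          _ = _ := by rw [mul_pow]; norm_num
    _ = 4 * ∫⁻ ω, (eVariationOn (fun t => A t ω) (Set.Icc 0 T)) ^ 2 ∂P :=
        lintegral_const_mul' _ _ (by simp)
    _ < ⊤ := ENNReal.mul_lt_top (by simp) h.sq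

lemma ae_lsIntegral_eq (h : IsDrift P T A) {K : ℝ≥0 → Ω → ℝ}
    (hK : Measurable fun z : Ω × ℝ≥0 => K z.2 z.1)
    (hK2 : ∫⁻ ω, (⨆ t ∈ Set.Icc (0 : ℝ≥0) T, ‖K t ω‖ₑ ^ 2) ∂P < ⊤) :
    ∀ᵐ ω ∂P, lsIntegral T (fun t => K t ω) (fun t => A t ω)
      = ∫ t, K t ω ∂(h.path ω).varMeasure - ∫ t, K t ω ∂(h.path ω).varSubMeasure := by
  filter_upwards [(h.integrable_varMeasure hK hK2).1, (h.integrable_varSubMeasure hK hK2).1]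
    with ω h1 h2 using (h.path ω).lsIntegral_eq h1 h2

lemma integrable_lsIntegral (h : IsDrift P T A) {K : ℝ≥0 → Ω → ℝ}
    (hK : Measurable fun z : Ω × ℝ≥0 => K z.2 z.1)
    (hK2 : ∫⁻ ω, (⨆ t ∈ Set.Icc (0 : ℝ≥0) T, ‖K t ω‖ₑ ^ 2) ∂P < ⊤) :
    Integrable (fun ω => lsIntegral T (fun t => K t ω) (fun t => A t ω)) P :=
  ((h.integrable_varMeasure hK hK2).2.sub (h.integrable_varSubMeasure hK hK2).2).congr
    ((h.ae_lsIntegral_eq hK hK2).mono fun _ hω => hω.symm)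

lemma ae_lsIntegral_add_smul (h : IsDrift P T A) {K k : ℝ≥0 → Ω → ℝ}
    (hK : Measurable fun z : Ω × ℝ≥0 => K z.2 z.1)
    (hK2 : ∫⁻ ω, (⨆ t ∈ Set.Icc (0 : ℝ≥0) T, ‖K t ω‖ₑ ^ 2) ∂P < ⊤)
    (hk : Measurable fun z : Ω × ℝ≥0 => k z.2 z.1)
    (hk2 : ∫⁻ ω, (⨆ t ∈ Set.Icc (0 : ℝ≥0) T, ‖k t ω‖ₑ ^ 2) ∂P < ⊤) (δ : ℝ) :
    ∀ᵐ ω ∂P, lsIntegral T (fun t => K t ω + δ * k t ω) (fun t => A t ω)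
      = lsIntegral T (fun t => K t ω) (fun t => A t ω)
        + δ * lsIntegral T (fun t => k t ω) (fun t => A t ω) := by
  filter_upwards [(h.integrable_varMeasure hK hK2).1, (h.integrable_varSubMeasure hK hK2).1,
    (h.integrable_varMeasure hk hk2).1, (h.integrable_varSubMeasure hk hk2).1] with ω h1 h2 h3 h4
  rw [(h.path ω).lsIntegral_eq h1 h2, (h.path ω).lsIntegral_eq h3 h4,
    (h.path ω).lsIntegral_eq (f := fun t => K t ω + δ * k t ω) (h1.add (h3.const_mul δ))
      (h2.add (h4.const_mul δ)),
    integral_add h1 (h3.const_mul δ), integral_add h2 (h4.const_mul δ), integral_const_mul,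
    integral_const_mul]
  ring

end IsDrift

/-! ### Square-integrable functions -/

section CauchySchwarz

variable {α : Type*} [MeasurableSpace α] {μ : Measure α} {f g : α → ℝ}

lemma integrable_mul_of_memLp (hf : MemLp f 2 μ) (hg : MemLp g 2 μ) :
    Integrable (fun x => f x * g x) μ := hf.integrable_mul hg

lemma integrable_sq_of_memLp (hf : MemLp f 2 μ) : Integrable (fun x => f x ^ 2) μ :=
  hf.integrable_sq

lemma sq_integral_mul_le (hf : MemLp f 2 μ) (hg : MemLp g 2 μ) :
    (∫ x, f x * g x ∂μ) ^ 2 ≤ (∫ x, f x ^ 2 ∂μ) * ∫ x, g x ^ 2 ∂μ := by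
  have h : ∀ r : ℝ, 0 ≤ (∫ x, f x ^ 2 ∂μ) * (r * r) + (2 * ∫ x, f x * g x ∂μ) * r
      + ∫ x, g x ^ 2 ∂μ := by
    intro r
    have h1 : 0 ≤ ∫ x, (r * f x + g x) ^ 2 ∂μ := integral_nonneg fun x => sq_nonneg _
    have h2 : (fun x => (r * f x + g x) ^ 2)
        = fun x => (r * r) * f x ^ 2 + (2 * r) * (f x * g x) + g x ^ 2 := by
      ext x; ring
    have i1 : Integrable (fun x => (r * r) * f x ^ 2) μ := (integrable_sq_of_memLp hf).const_mul _
    have i2 : Integrable (fun x => (2 * r) * (f x * g x)) μ :=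
      (integrable_mul_of_memLp hf hg).const_mul _
    rw [h2, integral_add (i1.fun_add i2) (integrable_sq_of_memLp hg), integral_add i1 i2,
      integral_const_mul, integral_const_mul] at h1
    linarith
  have := discrim_le_zero h
  rw [discrim] at this
  linarith

lemma abs_integral_mul_le (hf : MemLp f 2 μ) (hg : MemLp g 2 μ) :
    ∫ x, |f x * g x| ∂μ ≤ √(∫ x, f x ^ 2 ∂μ) * √(∫ x, g x ^ 2 ∂μ) := by
  have h := sq_integral_mul_le hf.abs hg.abs
  simp only [Pi.abs_apply, sq_abs, ← abs_mul] at h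
  rw [← Real.sqrt_mul (integral_nonneg fun x => sq_nonneg _)]
  exact Real.le_sqrt_of_sq_le h

lemma abs_integral_le_sqrt (hf : MemLp f 2 μ) (hg : MemLp g 2 μ) :
    |∫ x, f x * g x ∂μ| ≤ √(∫ x, f x ^ 2 ∂μ) * √(∫ x, g x ^ 2 ∂μ) :=
  abs_integral_le_integral_abs.trans (abs_integral_mul_le hf hg)

end CauchySchwarz

/-! ### Iterated integrals in time -/

lemma integral_timeMeasure_indicator {T t : ℝ≥0} (ht : t ≤ T) (f : ℝ≥0 → ℝ) :
    ∫ s, (Set.Iic t).indicator f s ∂timeMeasure T = ∫ s in Set.Ioc 0 t, f s ∂lebesgue := by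
  have : Set.Iic t ∩ Set.Ioc 0 T = Set.Ioc 0 t := by
    ext s
    simp only [Set.mem_inter_iff, Set.mem_Iic, Set.mem_Ioc]
    exact ⟨fun h => ⟨h.2.1, h.1⟩, fun h => ⟨h.2, h.1, h.2.trans ht⟩⟩
  rw [integral_indicator measurableSet_Iic, timeMeasure,
    Measure.restrict_restrict measurableSet_Iic, this]

/-- Fubini's theorem on the triangle `s ≤ t`. -/
lemma integral_mul_primitive {T : ℝ≥0} {f g : ℝ≥0 → ℝ} (hf : Integrable f (timeMeasure T))
    (hg : Integrable g (timeMeasure T)) :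
    ∫ t, g t * (∫ s in Set.Ioc 0 t, f s ∂lebesgue) ∂timeMeasure T
      = ∫ s, f s * ((∫ t in Set.Ioc 0 T, g t ∂lebesgue) - ∫ t in Set.Ioc 0 s, g t ∂lebesgue)
          ∂timeMeasure T := by
  have hint : Integrable (Function.uncurry fun t s => g t * (Set.Iic t).indicator f s)
      ((timeMeasure T).prod (timeMeasure T)) := by
    have : (Function.uncurry fun t s => g t * (Set.Iic t).indicator f s)
        = {z : ℝ≥0 × ℝ≥0 | z.2 ≤ z.1}.indicator fun z => g z.1 * f z.2 := by
      ext ⟨t, s⟩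
      by_cases h : s ≤ t <;> simp [Function.uncurry, Set.indicator, h]
    rw [this]
    exact (hg.mul_prod hf).indicator (measurableSet_le measurable_snd measurable_fst)
  calc ∫ t, g t * (∫ s in Set.Ioc 0 t, f s ∂lebesgue) ∂timeMeasure T
      = ∫ t, ∫ s, g t * (Set.Iic t).indicator f s ∂timeMeasure T ∂timeMeasure T := by
        refine integral_congr_ae ?_
        filter_upwards [ae_timeMeasure_mem T] with t ht
        rw [integral_const_mul, integral_timeMeasure_indicator ht.2]
    _ = ∫ s, ∫ t, g t * (Set.Iic t).indicator f s ∂timeMeasure T ∂timeMeasure T :=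
        integral_integral_swap hint
    _ = _ := by
        refine integral_congr_ae ?_
        filter_upwards [ae_timeMeasure_mem T] with s hs
        have h1 : ∀ t, g t * (Set.Iic t).indicator f s = f s * (Set.Ici s).indicator g t := by
          intro t
          by_cases h : s ≤ t <;> simp [Set.indicator, h, mul_comm]
        simp only [h1]
        rw [integral_const_mul, integral_indicator measurableSet_Ici, ← setIntegral_Ioc_sub hg hs.2
          le_rfl, setIntegral_congr_set Ioi_ae_eq_Ici.symm, timeMeasure,
          Measure.restrict_restrict measurableSet_Ioi]
        have : Set.Ioi s ∩ Set.Ioc 0 T = Set.Ioc s T := by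
          ext t
          simp only [Set.mem_inter_iff, Set.mem_Ioi, Set.mem_Ioc]
          exact ⟨fun h => ⟨h.1, h.2.2⟩, fun h => ⟨h.1, zero_le.trans_lt h.1, h.2⟩⟩
        rw [this]

lemma sq_primitive {T : ℝ≥0} {f : ℝ≥0 → ℝ} (hf : Integrable f (timeMeasure T))
    (hfi : Integrable (fun t => f t * ∫ s in Set.Ioc 0 t, f s ∂lebesgue) (timeMeasure T)) :
    (∫ s in Set.Ioc 0 T, f s ∂lebesgue) ^ 2
      = 2 * ∫ t, f t * (∫ s in Set.Ioc 0 t, f s ∂lebesgue) ∂timeMeasure T := by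
  have h := integral_mul_primitive hf hf
  simp only [mul_sub] at h
  rw [integral_sub (hf.mul_const _) hfi, integral_mul_const] at h
  change _ = (∫ s in Set.Ioc 0 T, f s ∂lebesgue) * _ - _ at h
  linarith

/-! ### Processes as functions on `Ω × [0, T]` -/

lemma predictable_le_prod {Ω : Type*} [mΩ : MeasurableSpace Ω] (𝓕 : Filtration ℝ≥0 mΩ) :
    𝓕.predictable ≤ (inferInstance : MeasurableSpace (ℝ≥0 × Ω)) :=
  measurableSpace_le_predictable_of_measurableSet
    (fun _ hA => (measurableSet_singleton _).prod (𝓕.le _ _ hA))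
    (fun i _ hA => measurableSet_Ioi.prod (𝓕.le i _ hA))

variable {Ω : Type*} [mΩ : MeasurableSpace Ω] {P : Measure Ω} [IsProbabilityMeasure P]
  {𝓕 : Filtration ℝ≥0 mΩ} {T : ℝ≥0}

lemma predictable_zero (𝓕 : Filtration ℝ≥0 mΩ) :
    IsStronglyPredictable 𝓕 fun (_ : ℝ≥0) (_ : Ω) => (0 : ℝ) :=
  @stronglyMeasurable_const _ _ 𝓕.predictable _ (0 : ℝ)

omit [IsProbabilityMeasure P] in
lemma measurable_of_predictable {X : ℝ≥0 → Ω → ℝ} (hX : IsStronglyPredictable 𝓕 X) :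
    Measurable fun z : Ω × ℝ≥0 => X z.2 z.1 :=
  (StronglyMeasurable.mono hX (predictable_le_prod 𝓕)).measurable.comp measurable_swap

/-- The process `X`, seen as a function on `Ω × ℝ≥0`. -/
def onProd (X : ℝ≥0 → Ω → ℝ) : Ω × ℝ≥0 → ℝ := fun z => X z.2 z.1

/-- The product of `P` with Lebesgue measure on `(0, T]`. -/
def prodMeasure (P : Measure Ω) (T : ℝ≥0) : Measure (Ω × ℝ≥0) := P.prod (timeMeasure T)

instance : IsFiniteMeasure (prodMeasure P T) := by unfold prodMeasure; infer_instance

omit [IsProbabilityMeasure P] in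
lemma lintegral_sq_eq [SFinite P] {X : ℝ≥0 → Ω → ℝ} (hX : Measurable (onProd X)) :
    ∫⁻ ω, (∫⁻ s in Set.Icc (0 : ℝ) T, ‖X s.toNNReal ω‖ₑ ^ 2) ∂P
      = ∫⁻ z, ‖onProd X z‖ₑ ^ 2 ∂prodMeasure P T := by
  rw [prodMeasure, lintegral_prod _ (hX.enorm.pow_const 2).aemeasurable]
  refine lintegral_congr fun ω => ?_
  exact setLIntegral_lebesgue (fun s => ‖X s ω‖ₑ ^ 2) T

omit [IsProbabilityMeasure P] in
lemma memLp_two_iff {X : ℝ≥0 → Ω → ℝ} (hX : Measurable (onProd X)) :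
    MemLp (onProd X) 2 (prodMeasure P T) ↔ ∫⁻ z, ‖onProd X z‖ₑ ^ 2 ∂prodMeasure P T < ⊤ := by
  have h := eLpNorm_lt_top_iff_lintegral_rpow_enorm_lt_top (p := 2) (f := onProd X)
    (μ := prodMeasure P T) (by norm_num) (by norm_num)
  simp only [ENNReal.toReal_ofNat, ENNReal.rpow_ofNat] at h
  exact ⟨fun hm => h.1 hm.2, fun hm => ⟨hX.aestronglyMeasurable, h.2 hm⟩⟩

lemma memL2_iff {X : ℝ≥0 → Ω → ℝ} :
    MemL2 P 𝓕 T X ↔ IsStronglyPredictable 𝓕 X ∧ MemLp (onProd X) 2 (prodMeasure P T) := by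
  refine and_congr_right fun hX => ?_
  rw [lintegral_sq_eq (measurable_of_predictable hX),
    ← memLp_two_iff (measurable_of_predictable hX)]

lemma MemL2.memLp {X : ℝ≥0 → Ω → ℝ} (hX : MemL2 P 𝓕 T X) :
    MemLp (onProd X) 2 (prodMeasure P T) := (memL2_iff.1 hX).2

omit [IsProbabilityMeasure P] in
lemma MemL2.measurable {X : ℝ≥0 → Ω → ℝ} (hX : MemL2 P 𝓕 T X) : Measurable (onProd X) :=
  measurable_of_predictable hX.1

omit [IsProbabilityMeasure P] in
lemma MemS2.measurable {X : ℝ≥0 → Ω → ℝ} (hX : MemS2 P 𝓕 T X) : Measurable (onProd X) :=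
  measurable_of_predictable hX.1

omit [IsProbabilityMeasure P] in
lemma MemS2.memL2 {X : ℝ≥0 → Ω → ℝ} (hX : MemS2 P 𝓕 T X) : MemL2 P 𝓕 T X := by
  refine ⟨hX.1, ?_⟩
  calc ∫⁻ ω, (∫⁻ s in Set.Icc (0 : ℝ) T, ‖X s.toNNReal ω‖ₑ ^ 2) ∂P
      ≤ ∫⁻ ω, (⨆ t ∈ Set.Icc (0 : ℝ≥0) T, ‖X t ω‖ₑ ^ 2) * ENNReal.ofReal T ∂P := by
        refine lintegral_mono fun ω => ?_
        have h := setLIntegral_mono' (μ := volume) (measurableSet_Icc (a := (0 : ℝ)) (b := T))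
          (f := fun s => ‖X s.toNNReal ω‖ₑ ^ 2)
          (g := fun _ => ⨆ t ∈ Set.Icc (0 : ℝ≥0) T, ‖X t ω‖ₑ ^ 2) fun s hs =>
            le_iSup₂ (f := fun t (_ : t ∈ Set.Icc (0 : ℝ≥0) T) => ‖X t ω‖ₑ ^ 2) s.toNNReal
              ⟨zero_le, Real.toNNReal_le_iff_le_coe.2 hs.2⟩
        simpa using h
    _ = (∫⁻ ω, (⨆ t ∈ Set.Icc (0 : ℝ≥0) T, ‖X t ω‖ₑ ^ 2) ∂P) * ENNReal.ofReal T :=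
        lintegral_mul_const' _ _ (by simp)
    _ < ⊤ := ENNReal.mul_lt_top hX.2 (by simp)

lemma MemS2.memLp {X : ℝ≥0 → Ω → ℝ} (hX : MemS2 P 𝓕 T X) :
    MemLp (onProd X) 2 (prodMeasure P T) := hX.memL2.memLp

lemma MemL2.add {X Y : ℝ≥0 → Ω → ℝ} (hX : MemL2 P 𝓕 T X) (hY : MemL2 P 𝓕 T Y) :
    MemL2 P 𝓕 T fun t ω => X t ω + Y t ω :=
  memL2_iff.2 ⟨StronglyMeasurable.add hX.1 hY.1, hX.memLp.add hY.memLp⟩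

lemma MemL2.const_mul {X : ℝ≥0 → Ω → ℝ} (hX : MemL2 P 𝓕 T X) (c : ℝ) :
    MemL2 P 𝓕 T fun t ω => c * X t ω :=
  memL2_iff.2 ⟨StronglyMeasurable.const_mul hX.1 c, hX.memLp.const_mul c⟩

lemma MemL2.sub {X Y : ℝ≥0 → Ω → ℝ} (hX : MemL2 P 𝓕 T X) (hY : MemL2 P 𝓕 T Y) :
    MemL2 P 𝓕 T fun t ω => X t ω - Y t ω :=
  memL2_iff.2 ⟨StronglyMeasurable.sub hX.1 hY.1, hX.memLp.sub hY.memLp⟩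

lemma memL2_sum {ι : Type*} (s : Finset ι) {X : ι → ℝ≥0 → Ω → ℝ}
    (hX : ∀ i ∈ s, MemL2 P 𝓕 T (X i)) : MemL2 P 𝓕 T fun t ω => ∑ i ∈ s, X i t ω := by
  classical
  induction s using Finset.induction_on with
  | empty =>
    exact memL2_iff.2 ⟨predictable_zero 𝓕, MemLp.zero'⟩
  | insert i s his ih =>
    simp only [Finset.sum_insert his]
    exact (hX i (Finset.mem_insert_self i s)).add
      (ih fun j hj => hX j (Finset.mem_insert_of_mem hj))

/-- The process `X` is jointly measurable and square-integrable for `P ⊗ dt` on `Ω × (0, T]`. -/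
structure IsSqInt (P : Measure Ω) (T : ℝ≥0) (X : ℝ≥0 → Ω → ℝ) : Prop where
  measurable : Measurable (onProd X)
  memLp : MemLp (onProd X) 2 (prodMeasure P T)

lemma MemL2.sqInt {X : ℝ≥0 → Ω → ℝ} (hX : MemL2 P 𝓕 T X) : IsSqInt P T X :=
  ⟨hX.measurable, hX.memLp⟩

lemma IsSqInt.ae_integrable {X : ℝ≥0 → Ω → ℝ} (hX : IsSqInt P T X) :
    ∀ᵐ ω ∂P, Integrable (fun s => X s ω) (timeMeasure T) :=
  (hX.memLp.integrable (by norm_num)).prod_right_ae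

lemma IsSqInt.ae_memLp {X : ℝ≥0 → Ω → ℝ} (hX : IsSqInt P T X) :
    ∀ᵐ ω ∂P, MemLp (fun s => X s ω) 2 (timeMeasure T) := by
  have h := hX.memLp.integrable_sq.prod_right_ae
  filter_upwards [h] with ω hω
  exact (memLp_two_iff_integrable_sq
    (hX.measurable.comp measurable_prodMk_left).aestronglyMeasurable).2 hω

instance : SigmaFinite lebesgue := by
  refine ⟨⟨⟨fun n : ℕ => Set.Iic (n : ℝ≥0), fun _ => trivial, fun n => ?_, ?_⟩⟩⟩
  · rw [← Set.Icc_bot, measure_congr Ioc_ae_eq_Icc.symm, lebesgue_Ioc]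
    exact ENNReal.ofReal_lt_top
  · exact Set.eq_univ_of_forall fun t =>
      Set.mem_iUnion.2 ((exists_nat_ge t).imp fun n hn => hn)

omit [IsProbabilityMeasure P] in
lemma measurable_timeInt {X : ℝ≥0 → Ω → ℝ} (hX : Measurable (onProd X)) :
    Measurable (onProd (timeInt X)) := by
  have h : onProd (timeInt X) = fun z : Ω × ℝ≥0 =>
      ∫ s, {p : (Ω × ℝ≥0) × ℝ≥0 | p.2 ∈ Set.Ioc 0 p.1.2}.indicator (fun p => X p.2 p.1.1) (z, s)
        ∂lebesgue := by
    ext z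
    rw [onProd, timeInt_eq, ← integral_indicator measurableSet_Ioc]
    rfl
  rw [h]
  refine (StronglyMeasurable.integral_prod_right (ν := lebesgue)
    (f := fun z s => {p : (Ω × ℝ≥0) × ℝ≥0 | p.2 ∈ Set.Ioc 0 p.1.2}.indicator
      (fun p => X p.2 p.1.1) (z, s)) ?_).measurable
  refine Measurable.stronglyMeasurable ?_
  refine Measurable.indicator (f := fun p : (Ω × ℝ≥0) × ℝ≥0 => X p.2 p.1.1) ?_ ?_
  · exact hX.comp ((measurable_fst.comp measurable_fst).prodMk measurable_snd)
  · have h1 : Measurable fun p : (Ω × ℝ≥0) × ℝ≥0 => p.2 := measurable_snd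
    have h2 : Measurable fun p : (Ω × ℝ≥0) × ℝ≥0 => p.1.2 := measurable_fst.snd
    have h3 : MeasurableSet ({p : (Ω × ℝ≥0) × ℝ≥0 | 0 < p.2} ∩ {p | p.2 ≤ p.1.2}) :=
      (measurableSet_lt measurable_const h1).inter (measurableSet_le h1 h2)
    exact h3

omit [IsProbabilityMeasure P] in
lemma measurable_timeInt_apply {X : ℝ≥0 → Ω → ℝ} (hX : Measurable (onProd X)) (t : ℝ≥0) :
    Measurable (timeInt X t) := (measurable_timeInt hX).comp measurable_prodMk_right

omit [IsProbabilityMeasure P] mΩ in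
lemma sq_timeInt_le {X : ℝ≥0 → Ω → ℝ} {ω : Ω} (hX : MemLp (fun s => X s ω) 2 (timeMeasure T))
    {t : ℝ≥0} (ht : t ≤ T) :
    (timeInt X t ω) ^ 2 ≤ T * ∫ s, (X s ω) ^ 2 ∂timeMeasure T := by
  have h1 : timeInt X t ω = ∫ s, (Set.Iic t).indicator (fun _ => (1 : ℝ)) s * X s ω
      ∂timeMeasure T := by
    rw [timeInt_eq, ← integral_timeMeasure_indicator ht]
    congr 1; ext s
    by_cases h : s ∈ Set.Iic t <;> simp [h]
  have h2 : MemLp ((Set.Iic t).indicator (fun _ => (1 : ℝ))) 2 (timeMeasure T) :=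
    (memLp_const 1).indicator measurableSet_Iic
  rw [h1]
  refine (sq_integral_mul_le h2 hX).trans ?_
  refine mul_le_mul_of_nonneg_right ?_ (integral_nonneg fun s => sq_nonneg (X s ω))
  · calc ∫ s, ((Set.Iic t).indicator (fun _ => (1 : ℝ)) s) ^ 2 ∂timeMeasure T
        ≤ ∫ s, (1 : ℝ) ∂timeMeasure T := by
          refine integral_mono h2.integrable_sq (integrable_const _) fun s => ?_
          by_cases h : s ∈ Set.Iic t <;> simp [h]
      _ = T := by
          simp only [integral_const, smul_eq_mul, mul_one, measureReal_def, timeMeasure,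
            Measure.restrict_apply_univ, lebesgue_Ioc]
          simp

lemma IsSqInt.memLp_timeInt {X : ℝ≥0 → Ω → ℝ} (hX : IsSqInt P T X) :
    MemLp (onProd (timeInt X)) 2 (prodMeasure P T) := by
  have hm := measurable_timeInt hX.measurable
  refine (memLp_two_iff_integrable_sq hm.aestronglyMeasurable).2 ?_
  have hg : Integrable (fun ω => T * ∫ s, (X s ω) ^ 2 ∂timeMeasure T) P :=
    (hX.memLp.integrable_sq.integral_prod_left).const_mul _
  have hg' : Integrable (fun z : Ω × ℝ≥0 => T * ∫ s, (X s z.1) ^ 2 ∂timeMeasure T)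
      (prodMeasure P T) := hg.comp_fst _
  refine hg'.mono (hm.pow_const 2).aestronglyMeasurable ?_
  have h1 : ∀ᵐ z ∂prodMeasure P T, MemLp (fun s => X s z.1) 2 (timeMeasure T) :=
    Measure.quasiMeasurePreserving_fst.ae hX.ae_memLp
  have h2 : ∀ᵐ z ∂prodMeasure P T, z.2 ∈ Set.Ioc 0 T :=
    Measure.quasiMeasurePreserving_snd.ae (ae_timeMeasure_mem T)
  filter_upwards [h1, h2] with z hz1 hz2
  rw [Real.norm_of_nonneg (sq_nonneg _)]
  exact (sq_timeInt_le hz1 hz2.2).trans (le_abs_self _)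

lemma IsSqInt.integrable_sq_timeInt_apply {X : ℝ≥0 → Ω → ℝ} (hX : IsSqInt P T X) {t : ℝ≥0}
    (ht : t ≤ T) : Integrable (fun ω => (timeInt X t ω) ^ 2) P := by
  have hg : Integrable (fun ω => T * ∫ s, (X s ω) ^ 2 ∂timeMeasure T) P :=
    (hX.memLp.integrable_sq.integral_prod_left).const_mul _
  refine hg.mono ((measurable_timeInt_apply hX.measurable t).pow_const 2).aestronglyMeasurable ?_
  filter_upwards [hX.ae_memLp] with ω hω
  rw [Real.norm_of_nonneg (sq_nonneg _)]
  exact (sq_timeInt_le hω ht).trans (le_abs_self _)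

lemma IsSqInt.memLp_timeInt_apply {X : ℝ≥0 → Ω → ℝ} (hX : IsSqInt P T X) {t : ℝ≥0}
    (ht : t ≤ T) : MemLp (timeInt X t) 2 P :=
  (memLp_two_iff_integrable_sq
    (measurable_timeInt_apply hX.measurable t).aestronglyMeasurable).2
    (hX.integrable_sq_timeInt_apply ht)

lemma integral_prodMeasure {f : Ω × ℝ≥0 → ℝ} (hf : Integrable f (prodMeasure P T)) :
    ∫ z, f z ∂prodMeasure P T = ∫ ω, ∫ s, f (ω, s) ∂timeMeasure T ∂P := integral_prod f hf

/-- The remaining integral `∫_t^T X_s ds`. -/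
def tailInt (T : ℝ≥0) (X : ℝ≥0 → Ω → ℝ) : ℝ≥0 → Ω → ℝ :=
  fun t ω => timeInt X T ω - timeInt X t ω

lemma IsSqInt.memLp_tailInt {X : ℝ≥0 → Ω → ℝ} (hX : IsSqInt P T X) :
    MemLp (onProd (tailInt T X)) 2 (prodMeasure P T) := by
  refine MemLp.sub (f := fun z : Ω × ℝ≥0 => timeInt X T z.1) ?_ hX.memLp_timeInt
  exact (hX.memLp_timeInt_apply le_rfl).comp_fst _

lemma IsSqInt.primitive {X : ℝ≥0 → Ω → ℝ} (hX : IsSqInt P T X) : IsSqInt P T (timeInt X) :=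
  ⟨measurable_timeInt hX.measurable, hX.memLp_timeInt⟩

lemma IsSqInt.tail {X : ℝ≥0 → Ω → ℝ} (hX : IsSqInt P T X) : IsSqInt P T (tailInt T X) :=
  ⟨((measurable_timeInt_apply hX.measurable T).comp measurable_fst).sub
    (measurable_timeInt hX.measurable), hX.memLp_tailInt⟩

/-- Integration by parts in time. -/
lemma integral_timeInt_mul {X u : ℝ≥0 → Ω → ℝ} (hX : IsSqInt P T X) (hu : IsSqInt P T u) :
    ∫ z, onProd X z * onProd (timeInt u) z ∂prodMeasure P T
      = ∫ z, onProd u z * onProd (tailInt T X) z ∂prodMeasure P T := by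
  rw [integral_prodMeasure (integrable_mul_of_memLp hX.memLp hu.memLp_timeInt),
    integral_prodMeasure (integrable_mul_of_memLp hu.memLp hX.memLp_tailInt)]
  refine integral_congr_ae ?_
  filter_upwards [hX.ae_integrable, hu.ae_integrable] with ω h1 h2
  have := integral_mul_primitive h2 h1
  simpa only [onProd, tailInt, timeInt_eq] using this

/-- `E[(∫₀ᵗ u)²] ≤ 2 ‖∫₀ u‖ ‖u‖`, since the square of a primitive of `u` is a primitive of
`2 u ∫₀ u`. -/
lemma IsSqInt.integral_sq_timeInt_le {u : ℝ≥0 → Ω → ℝ} (hu : IsSqInt P T u) {t : ℝ≥0}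
    (ht : t ≤ T) :
    ∫ ω, (timeInt u t ω) ^ 2 ∂P
      ≤ 2 * (√(∫ z, onProd (timeInt u) z ^ 2 ∂prodMeasure P T)
        * √(∫ z, onProd u z ^ 2 ∂prodMeasure P T)) := by
  have hint := integrable_mul_of_memLp hu.memLp_timeInt hu.memLp
  have habs : Integrable (fun ω => ∫ s, |onProd (timeInt u) (ω, s) * onProd u (ω, s)|
    ∂timeMeasure T) P := hint.abs.integral_prod_left
  calc ∫ ω, (timeInt u t ω) ^ 2 ∂P
      ≤ ∫ ω, 2 * ∫ s, |onProd (timeInt u) (ω, s) * onProd u (ω, s)|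
          ∂timeMeasure T ∂P := by
        refine integral_mono_ae (hu.integrable_sq_timeInt_apply ht) (habs.const_mul 2) ?_
        filter_upwards [hu.ae_integrable, hint.prod_right_ae] with ω h1 h2
        have hsub : Set.Ioc 0 t ⊆ Set.Ioc 0 T := Set.Ioc_subset_Ioc_right ht
        have h1' : Integrable (fun s => u s ω) (timeMeasure t) :=
          IntegrableOn.mono_set (t := Set.Ioc 0 T) h1 hsub
        have h2' : Integrable (fun s => u s ω * timeInt u s ω) (timeMeasure T) :=
          h2.congr (.of_forall fun s => mul_comm _ _)
        have h3' : Integrable (fun s => u s ω * timeInt u s ω) (timeMeasure t) :=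
          IntegrableOn.mono_set (t := Set.Ioc 0 T) h2' hsub
        have key := sq_primitive h1' (by simpa only [timeInt_eq] using h3')
        simp only [← timeInt_eq] at key
        rw [key]
        refine mul_le_mul_of_nonneg_left ?_ zero_le_two
        calc ∫ s, u s ω * timeInt u s ω ∂timeMeasure t
            ≤ ∫ s, |u s ω * timeInt u s ω| ∂timeMeasure t :=
              integral_mono h3' h3'.abs fun s => le_abs_self _
          _ ≤ ∫ s, |u s ω * timeInt u s ω| ∂timeMeasure T :=
              setIntegral_mono_set h2'.abs (.of_forall fun s => abs_nonneg _)
                (LE.le.eventuallyLE hsub)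
          _ = _ := by simp only [onProd, mul_comm]
    _ = 2 * ∫ z, |onProd (timeInt u) z * onProd u z| ∂prodMeasure P T := by
        rw [integral_const_mul, integral_prodMeasure hint.abs]
    _ ≤ _ := by
        refine mul_le_mul_of_nonneg_left ?_ zero_le_two
        exact abs_integral_mul_le hu.memLp_timeInt hu.memLp

/-! ### First-order conditions -/

/-- The first-order condition at the maximum of a parabola. -/
lemma eq_zero_of_forall_mul_sub_sq_le {L R : ℝ} (h : ∀ δ : ℝ, δ * L - δ ^ 2 * R ≤ 0) : L = 0 := by
  by_contra hL
  have hR : 0 < 1 + |R| := by positivity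
  have h1 := h (L / (1 + |R|))
  have h2 : L / (1 + |R|) * L - (L / (1 + |R|)) ^ 2 * R
      = L ^ 2 * (1 + |R| - R) / (1 + |R|) ^ 2 := by
    field_simp
  have h3 : 0 < 1 + |R| - R := by linarith [le_abs_self R]
  rw [h2] at h1
  have : 0 < L ^ 2 * (1 + |R| - R) / (1 + |R|) ^ 2 := by positivity
  linarith

lemma integral_quadratic {α : Type*} [MeasurableSpace α] {μ : Measure α} {v f f' : α → ℝ}
    (hv : MemLp v 2 μ) (hf : MemLp f 2 μ) (hf' : MemLp f' 2 μ) (l c δ : ℝ) :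
    ∫ x, (l * v x * (f x + δ * f' x) + c * (f x + δ * f' x) ^ 2) ∂μ
      = ∫ x, (l * v x * f x + c * f x ^ 2) ∂μ
        + δ * (l * ∫ x, v x * f' x ∂μ + 2 * c * ∫ x, f x * f' x ∂μ)
        + δ ^ 2 * (c * ∫ x, f' x ^ 2 ∂μ) := by
  have i1 : Integrable (fun x => l * v x * f x + c * f x ^ 2) μ := by
    have := ((integrable_mul_of_memLp hv hf).const_mul l).add (hf.integrable_sq.const_mul c)
    refine this.congr (.of_forall fun x => ?_)
    simp only [Pi.add_apply]; ring
  have i2 : Integrable (fun x => (δ * l) * (v x * f' x)) μ :=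
    (integrable_mul_of_memLp hv hf').const_mul _
  have i3 : Integrable (fun x => (δ * (2 * c)) * (f x * f' x)) μ :=
    (integrable_mul_of_memLp hf hf').const_mul _
  have i4 : Integrable (fun x => (δ ^ 2 * c) * f' x ^ 2) μ := hf'.integrable_sq.const_mul _
  have h : (fun x => l * v x * (f x + δ * f' x) + c * (f x + δ * f' x) ^ 2)
      = fun x => ((l * v x * f x + c * f x ^ 2) + (δ * l) * (v x * f' x)
        + (δ * (2 * c)) * (f x * f' x)) + (δ ^ 2 * c) * f' x ^ 2 := by
    ext x; ring
  rw [h, integral_add ((i1.fun_add i2).fun_add i3) i4, integral_add (i1.fun_add i2) i3,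
    integral_add i1 i2, integral_const_mul, integral_const_mul, integral_const_mul]
  ring

omit [IsProbabilityMeasure P] in
lemma IsH2WithDrift.isDrift {S A : ℝ≥0 → Ω → ℝ} (h : IsH2WithDrift P 𝓕 T S A) :
    IsDrift P T A where
  measurable t := ((h.2.2.1.stronglyAdapted t).mono (𝓕.le t)).measurable
  path ω := ⟨(h.2.2.2.2.1 ω).1, h.2.2.2.2.2.1 ω⟩
  sq := h.2.2.2.2.2.2

omit mΩ [IsProbabilityMeasure P] in
lemma timeInt_add_const_mul {X Y : ℝ≥0 → Ω → ℝ} {ω : Ω}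
    (hX : Integrable (fun s => X s ω) (timeMeasure T))
    (hY : Integrable (fun s => Y s ω) (timeMeasure T)) (c : ℝ) {t : ℝ≥0} (ht : t ≤ T) :
    timeInt (fun t ω => X t ω + c * Y t ω) t ω = timeInt X t ω + c * timeInt Y t ω := by
  have hsub : Set.Ioc 0 t ⊆ Set.Ioc 0 T := Set.Ioc_subset_Ioc_right ht
  have hX' : IntegrableOn (fun s => X s ω) (Set.Ioc 0 t) lebesgue :=
    IntegrableOn.mono_set (t := Set.Ioc 0 T) hX hsub
  have hY' : IntegrableOn (fun s => Y s ω) (Set.Ioc 0 t) lebesgue :=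
    IntegrableOn.mono_set (t := Set.Ioc 0 T) hY hsub
  simp only [timeInt_eq]
  rw [integral_add hX' (hY'.const_mul c), integral_const_mul]

lemma MemS2.add_const_mul {K k : ℝ≥0 → Ω → ℝ} (hK : MemS2 P 𝓕 T K)
    (hk : IsStronglyPredictable 𝓕 k) {C : ℝ} (hC : ∀ t ω, |k t ω| ≤ C) (δ : ℝ) :
    MemS2 P 𝓕 T fun t ω => K t ω + δ * k t ω := by
  refine ⟨StronglyMeasurable.add hK.1 (StronglyMeasurable.const_mul hk δ), ?_⟩
  have hle : ∀ ω, (⨆ t ∈ Set.Icc (0 : ℝ≥0) T, ‖K t ω + δ * k t ω‖ₑ ^ 2)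
      ≤ 2 * (⨆ t ∈ Set.Icc (0 : ℝ≥0) T, ‖K t ω‖ₑ ^ 2) + 2 * ENNReal.ofReal (|δ| * C) ^ 2 := by
    intro ω
    refine iSup₂_le fun t ht => ?_
    have h1 : ‖K t ω + δ * k t ω‖ₑ ≤ ‖K t ω‖ₑ + ENNReal.ofReal (|δ| * C) := by
      refine (enorm_add_le _ _).trans ?_
      gcongr
      rw [Real.enorm_eq_ofReal_abs, abs_mul]
      exact ENNReal.ofReal_le_ofReal (by gcongr; exact hC t ω)
    have h2 : ∀ x y : ℝ≥0∞, (x + y) ^ 2 ≤ 2 * x ^ 2 + 2 * y ^ 2 := by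
      intro x y
      have := ENNReal.rpow_add_le_mul_rpow_add_rpow x y (p := 2) (by norm_num)
      norm_num at this
      rw [← mul_add]
      exact this
    calc ‖K t ω + δ * k t ω‖ₑ ^ 2 ≤ (‖K t ω‖ₑ + ENNReal.ofReal (|δ| * C)) ^ 2 := by gcongr
      _ ≤ 2 * ‖K t ω‖ₑ ^ 2 + 2 * ENNReal.ofReal (|δ| * C) ^ 2 := h2 _ _
      _ ≤ _ := by
        gcongr
        exact le_iSup₂ (f := fun t (_ : t ∈ Set.Icc (0 : ℝ≥0) T) => ‖K t ω‖ₑ ^ 2) t ht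
  refine (lintegral_mono hle).trans_lt ?_
  rw [lintegral_add_right _ measurable_const, lintegral_const_mul' _ _ (by simp), lintegral_const]
  exact ENNReal.add_lt_top.2 ⟨ENNReal.mul_lt_top (by simp) hK.2,
    ENNReal.mul_lt_top (ENNReal.mul_lt_top (by simp)
      (ENNReal.pow_lt_top ENNReal.ofReal_lt_top)) (by simp)⟩

lemma memS2_of_bounded {k : ℝ≥0 → Ω → ℝ}
    (hk : IsStronglyPredictable 𝓕 k) {C : ℝ} (hC : ∀ t ω, |k t ω| ≤ C) :
    MemS2 P 𝓕 T k := by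
  have h0 : MemS2 P 𝓕 T fun _ _ => (0 : ℝ) := ⟨predictable_zero 𝓕, by simp⟩
  simpa using h0.add_const_mul hk hC 1

/-- The goal functional of a dealer as a functional on `L²(P ⊗ dt)`. -/
lemma goal_dealers_eq {M : ℕ} {ρd lam : ℝ} {A v K u : ℝ≥0 → Ω → ℝ} (hA : IsDrift P T A)
    (hv : MemL2 P 𝓕 T v) (hK : MemS2 P 𝓕 T K) (hu : MemL2 P 𝓕 T u) (a : Fin M) :
    (dealers Ω M ρd).goal P T lam A v a K u
      = ∫ ω, lsIntegral T (fun t => K t ω) (fun t => A t ω) ∂P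
        - ∫ z, (lam * onProd v z * onProd u z + lam * (1 / M) * onProd u z ^ 2) ∂prodMeasure P T
        - 1 / (2 * ρd) * ∫ z, (onProd K z + onProd (timeInt u) z) ^ 2 ∂prodMeasure P T := by
  have hcost : Integrable (fun z => lam * onProd v z * onProd u z
      + lam * (1 / M) * onProd u z ^ 2) (prodMeasure P T) := by
    have := ((integrable_mul_of_memLp hv.memLp hu.memLp).const_mul lam).add
      (hu.memLp.integrable_sq.const_mul (lam * (1 / M)))
    refine this.congr (.of_forall fun x => ?_)
    simp only [Pi.add_apply]; ring
  have hrisk : Integrable (fun z => 1 / (2 * ρd) * (onProd K z + onProd (timeInt u) z) ^ 2)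
      (prodMeasure P T) := (hK.memLp.add hu.sqInt.memLp_timeInt).integrable_sq.const_mul _
  have h1 : ∀ ω, timeInt (fun t ω => lam * v t ω * u t ω
      + (lam * (dealers Ω M ρd).mass a + (dealers Ω M ρd).cost a / 2) * (u t ω) ^ 2) T ω
      = ∫ s, (lam * onProd v (ω, s) * onProd u (ω, s) + lam * (1 / M) * onProd u (ω, s) ^ 2)
        ∂timeMeasure T := by
    intro ω
    rw [timeInt_eq]
    simp [dealers, onProd, timeMeasure]
  have h2 : ∀ ω, timeInt (fun t ω => 1 / (2 * (dealers Ω M ρd).tol a)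
      * ((dealers Ω M ρd).target a t ω - K t ω - timeInt u t ω) ^ 2) T ω
      = ∫ s, 1 / (2 * ρd) * (onProd K (ω, s) + onProd (timeInt u) (ω, s)) ^ 2
        ∂timeMeasure T := by
    intro ω
    rw [timeInt_eq]
    change ∫ s, _ ∂timeMeasure T = _
    congr 1; ext s
    simp only [dealers, onProd]
    ring
  rw [Agents.goal]
  simp only [h1, h2]
  rw [integral_sub (hA.integrable_lsIntegral hK.measurable hK.2) (hcost.integral_prod_left),
    ← integral_prodMeasure hcost, ← integral_prodMeasure hrisk, integral_const_mul]

/-- The first-order condition in the direction of a bounded predictable position `k` in the dealer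
market and of a trading rate `u'` in the open market. -/
lemma firstOrder {M : ℕ} {ρd lam : ℝ} {A v K u : ℝ≥0 → Ω → ℝ} (hA : IsDrift P T A)
    (hv : MemL2 P 𝓕 T v) (hK : MemS2 P 𝓕 T K) (hu : MemL2 P 𝓕 T u) (a : Fin M)
    (hopt : ∀ K' u' : ℝ≥0 → Ω → ℝ, MemS2 P 𝓕 T K' → MemL2 P 𝓕 T u' →
      (dealers Ω M ρd).goal P T lam A v a K' u' ≤ (dealers Ω M ρd).goal P T lam A v a K u)
    {k u' : ℝ≥0 → Ω → ℝ} (hk : IsStronglyPredictable 𝓕 k) {C : ℝ} (hC : ∀ t ω, |k t ω| ≤ C)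
    (hu' : MemL2 P 𝓕 T u') :
    ∫ ω, lsIntegral T (fun t => k t ω) (fun t => A t ω) ∂P
      - (lam * ∫ z, onProd v z * onProd u' z ∂prodMeasure P T
        + 2 * (lam * (1 / M)) * ∫ z, onProd u z * onProd u' z ∂prodMeasure P T)
      - 1 / ρd * ∫ z, (onProd K z + onProd (timeInt u) z)
          * (onProd k z + onProd (timeInt u') z) ∂prodMeasure P T = 0 := by
  have hkS : MemS2 P 𝓕 T k := memS2_of_bounded hk hC
  refine eq_zero_of_forall_mul_sub_sq_le (R := lam * (1 / M) *
    ∫ z, onProd u' z ^ 2 ∂prodMeasure P T + 1 / (2 * ρd) *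
    ∫ z, (onProd k z + onProd (timeInt u') z) ^ 2 ∂prodMeasure P T) fun δ => ?_
  have hKδ := hK.add_const_mul hk hC δ
  have huδ := hu.add (hu'.const_mul δ)
  have h := hopt _ _ hKδ huδ
  rw [goal_dealers_eq hA hv hKδ huδ, goal_dealers_eq hA hv hK hu] at h
  have h1 : ∫ ω, lsIntegral T (fun t => K t ω + δ * k t ω) (fun t => A t ω) ∂P
      = ∫ ω, lsIntegral T (fun t => K t ω) (fun t => A t ω) ∂P
        + δ * ∫ ω, lsIntegral T (fun t => k t ω) (fun t => A t ω) ∂P := by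
    rw [integral_congr_ae (hA.ae_lsIntegral_add_smul hK.measurable hK.2 hkS.measurable hkS.2 δ),
      integral_add (hA.integrable_lsIntegral hK.measurable hK.2)
        ((hA.integrable_lsIntegral hkS.measurable hkS.2).const_mul δ), integral_const_mul]
  have h2 := integral_quadratic hv.memLp hu.memLp hu'.memLp lam (lam * (1 / M)) δ
  have h3 : ∫ z, (onProd (fun t ω => K t ω + δ * k t ω) z
        + onProd (timeInt fun t ω => u t ω + δ * u' t ω) z) ^ 2 ∂prodMeasure P T
      = ∫ z, (0 * onProd v z * ((onProd K z + onProd (timeInt u) z)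
          + δ * (onProd k z + onProd (timeInt u') z))
        + 1 * ((onProd K z + onProd (timeInt u) z)
          + δ * (onProd k z + onProd (timeInt u') z)) ^ 2) ∂prodMeasure P T := by
    refine integral_congr_ae ?_
    have e1 : ∀ᵐ z ∂prodMeasure P T, Integrable (fun s => u s z.1) (timeMeasure T) :=
      Measure.quasiMeasurePreserving_fst.ae hu.sqInt.ae_integrable
    have e2 : ∀ᵐ z ∂prodMeasure P T, Integrable (fun s => u' s z.1) (timeMeasure T) :=
      Measure.quasiMeasurePreserving_fst.ae hu'.sqInt.ae_integrable
    have e3 : ∀ᵐ z ∂prodMeasure P T, z.2 ∈ Set.Ioc 0 T :=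
      Measure.quasiMeasurePreserving_snd.ae (ae_timeMeasure_mem T)
    filter_upwards [e1, e2, e3] with z h1 h2 h3
    have : timeInt (fun t ω => u t ω + δ * u' t ω) z.2 z.1
        = timeInt u z.2 z.1 + δ * timeInt u' z.2 z.1 := timeInt_add_const_mul h1 h2 δ h3.2
    simp only [onProd, this]
    ring
  have h4 := integral_quadratic hv.memLp (hK.memLp.add hu.sqInt.memLp_timeInt)
    (hkS.memLp.add hu'.sqInt.memLp_timeInt) 0 1 δ
  simp only [Pi.add_apply] at h4
  rw [h1, h3, h4] at h
  change _ - ∫ z, (lam * onProd v z * (onProd u z + δ * onProd u' z)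
    + lam * (1 / M) * (onProd u z + δ * onProd u' z) ^ 2) ∂prodMeasure P T - _ ≤ _ at h
  rw [h2] at h
  simp only [zero_mul, zero_add, one_mul, mul_one] at h
  have hρ : 1 / ρd = 2 * (1 / (2 * ρd)) := by
    rcases eq_or_ne ρd 0 with rfl | h0
    · simp
    · field_simp
  rw [hρ]
  linarith

/-! ### Aggregation over the dealers -/

/-- The dealers' average `M⁻¹ ∑_a u^a`. -/
def average {M : ℕ} (u : Fin M → ℝ≥0 → Ω → ℝ) : ℝ≥0 → Ω → ℝ :=
  fun t ω => ∑ a, 1 / (M : ℝ) * u a t ω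

lemma memL2_average {M : ℕ} {u : Fin M → ℝ≥0 → Ω → ℝ} (hu : ∀ a, MemL2 P 𝓕 T (u a)) :
    MemL2 P 𝓕 T (average u) := memL2_sum _ fun a _ => (hu a).const_mul _

omit [IsProbabilityMeasure P] mΩ in
lemma timeInt_sum {ι : Type*} (s : Finset ι) {X : ι → ℝ≥0 → Ω → ℝ} {ω : Ω}
    (hX : ∀ i ∈ s, Integrable (fun r => X i r ω) (timeMeasure T)) (c : ℝ) {t : ℝ≥0} (ht : t ≤ T) :
    timeInt (fun t ω => ∑ i ∈ s, c * X i t ω) t ω = ∑ i ∈ s, c * timeInt (X i) t ω := by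
  simp only [timeInt_eq]
  rw [integral_finsetSum]
  · exact Finset.sum_congr rfl fun i _ => integral_const_mul _ _
  · intro i hi
    exact (IntegrableOn.mono_set (t := Set.Ioc 0 T) (hX i hi)
      (Set.Ioc_subset_Ioc_right ht)).const_mul _

/-- The first-order conditions, averaged over the dealers: the dealers' aggregate exposure is
`∫₀ᵗ (ū - μN) ds`, and the impact terms add up to the factor `(M + 1) / M`. -/
lemma aggregate_firstOrder {M : ℕ} (hM : 1 ≤ M) {ρd lam : ℝ} {A KN μN : ℝ≥0 → Ω → ℝ}
    {K u : Fin M → ℝ≥0 → Ω → ℝ} (hA : IsDrift P T A)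
    (hμ : MemL2 P 𝓕 T μN) (hKN : ∀ᵐ ω ∂P, ∀ t ≤ T, KN t ω = timeInt μN t ω)
    (hK : ∀ a, MemS2 P 𝓕 T (K a)) (hu : ∀ a, MemL2 P 𝓕 T (u a))
    (hclear : ∀ᵐ ω ∂P, ∀ t ≤ T, KN t ω + ∑ a, (dealers Ω M ρd).mass a * K a t ω = 0)
    (hopt : ∀ a, ∀ K' u' : ℝ≥0 → Ω → ℝ, MemS2 P 𝓕 T K' → MemL2 P 𝓕 T u' →
      (dealers Ω M ρd).goal P T lam A ((dealers Ω M ρd).othersRate u a) a K' u'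
        ≤ (dealers Ω M ρd).goal P T lam A ((dealers Ω M ρd).othersRate u a) a (K a) (u a))
    {k u' : ℝ≥0 → Ω → ℝ} (hk : IsStronglyPredictable 𝓕 k) {C : ℝ} (hC : ∀ t ω, |k t ω| ≤ C)
    (hu' : MemL2 P 𝓕 T u') :
    ∫ ω, lsIntegral T (fun t => k t ω) (fun t => A t ω) ∂P
      - lam * ((M + 1) / M) * ∫ z, onProd (average u) z * onProd u' z ∂prodMeasure P T
      - 1 / ρd * ∫ z, onProd (timeInt fun t ω => average u t ω - μN t ω) z
          * (onProd k z + onProd (timeInt u') z) ∂prodMeasure P T = 0 := by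
  have hM0 : (M : ℝ) ≠ 0 := by positivity
  have hkS : MemS2 P 𝓕 T k := memS2_of_bounded hk hC
  set W : Ω × ℝ≥0 → ℝ := fun z => onProd k z + onProd (timeInt u') z with hW
  have hWm : MemLp W 2 (prodMeasure P T) := hkS.memLp.add hu'.sqInt.memLp_timeInt
  have hothers : ∀ a, MemL2 P 𝓕 T ((dealers Ω M ρd).othersRate u a) := fun a =>
    (memL2_average hu).sub ((hu a).const_mul _)
  have hfoc := fun a => firstOrder hA (hothers a) (hK a) (hu a) a (hopt a) hk hC hu'
  have hsplit : ∀ a, ∫ z, onProd ((dealers Ω M ρd).othersRate u a) z * onProd u' z ∂prodMeasure P T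
      = ∫ z, onProd (average u) z * onProd u' z ∂prodMeasure P T
        - 1 / M * ∫ z, onProd (u a) z * onProd u' z ∂prodMeasure P T := by
    intro a
    rw [← integral_const_mul, ← integral_sub (integrable_mul_of_memLp (memL2_average hu).memLp
      hu'.memLp) ((integrable_mul_of_memLp (hu a).memLp hu'.memLp).const_mul _)]
    congr 1; ext z
    simp only [onProd, Agents.othersRate, average, dealers]
    ring
  have hrate : ∑ a, 1 / (M : ℝ) * ∫ z, onProd (u a) z * onProd u' z ∂prodMeasure P T
      = ∫ z, onProd (average u) z * onProd u' z ∂prodMeasure P T := by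
    simp only [← integral_const_mul]
    rw [← integral_finsetSum _ fun a _ =>
      (integrable_mul_of_memLp (hu a).memLp hu'.memLp).const_mul _]
    congr 1; ext z
    simp only [onProd, average, Finset.sum_mul, mul_assoc]
  have hexp : ∑ a, 1 / (M : ℝ) * ∫ z, (onProd (K a) z + onProd (timeInt (u a)) z) * W z
        ∂prodMeasure P T
      = ∫ z, onProd (timeInt fun t ω => average u t ω - μN t ω) z * W z ∂prodMeasure P T := by
    simp only [← integral_const_mul]
    have hi : ∀ a ∈ Finset.univ, Integrable (fun z => 1 / (M : ℝ) *
        ((onProd (K a) z + onProd (timeInt (u a)) z) * W z)) (prodMeasure P T) := fun a _ =>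
      (integrable_mul_of_memLp ((hK a).memLp.add (hu a).sqInt.memLp_timeInt) hWm).const_mul _
    rw [← integral_finsetSum _ hi]
    refine integral_congr_ae ?_
    have e1 : ∀ᵐ z ∂prodMeasure P T, ∀ a, Integrable (fun s => u a s z.1) (timeMeasure T) :=
      Measure.quasiMeasurePreserving_fst.ae (ae_all_iff.2 fun a => (hu a).sqInt.ae_integrable)
    have e2 : ∀ᵐ z ∂prodMeasure P T, Integrable (fun s => average u s z.1) (timeMeasure T) :=
      Measure.quasiMeasurePreserving_fst.ae (memL2_average hu).sqInt.ae_integrable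
    have e3 : ∀ᵐ z ∂prodMeasure P T, Integrable (fun s => μN s z.1) (timeMeasure T) :=
      Measure.quasiMeasurePreserving_fst.ae hμ.sqInt.ae_integrable
    have e4 := Measure.quasiMeasurePreserving_fst (μ := P) (ν := timeMeasure T) |>.ae hKN
    have e5 := Measure.quasiMeasurePreserving_fst (μ := P) (ν := timeMeasure T) |>.ae hclear
    have e6 : ∀ᵐ z ∂prodMeasure P T, z.2 ∈ Set.Ioc 0 T :=
      Measure.quasiMeasurePreserving_snd.ae (ae_timeMeasure_mem T)
    filter_upwards [e1, e2, e3, e4, e5, e6] with z h1 h2 h3 h4 h5 h6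
    have h7 : timeInt (fun t ω => average u t ω - μN t ω) z.2 z.1
        = timeInt (average u) z.2 z.1 - timeInt μN z.2 z.1 := by
      have := timeInt_add_const_mul h2 h3 (-1) h6.2
      simpa only [neg_one_mul, ← sub_eq_add_neg] using this
    have h8 : timeInt (average u) z.2 z.1 = ∑ a, 1 / (M : ℝ) * timeInt (u a) z.2 z.1 :=
      timeInt_sum _ (fun a _ => h1 a) _ h6.2
    have h9 := h5 _ h6.2
    rw [h4 _ h6.2] at h9
    simp only [dealers] at h9
    simp only [onProd, h7, h8]
    rw [eq_neg_of_add_eq_zero_left h9, sub_neg_eq_add, ← Finset.sum_add_distrib, Finset.sum_mul]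
    exact Finset.sum_congr rfl fun a _ => by ring
  have hone : ∑ _a : Fin M, 1 / (M : ℝ) = 1 := by
    simp [hM0]
  have hsum : ∑ a : Fin M, 1 / (M : ℝ) *
      (∫ ω, lsIntegral T (fun t => k t ω) (fun t => A t ω) ∂P
        - (lam * ∫ z, onProd ((dealers Ω M ρd).othersRate u a) z * onProd u' z ∂prodMeasure P T
          + 2 * (lam * (1 / M)) * ∫ z, onProd (u a) z * onProd u' z ∂prodMeasure P T)
        - 1 / ρd * ∫ z, (onProd (K a) z + onProd (timeInt (u a)) z) * W z ∂prodMeasure P T) = 0 :=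
    Finset.sum_eq_zero fun a _ => by rw [hfoc a, mul_zero]
  have hterm : ∀ a : Fin M, 1 / (M : ℝ) *
      (∫ ω, lsIntegral T (fun t => k t ω) (fun t => A t ω) ∂P
        - (lam * ∫ z, onProd ((dealers Ω M ρd).othersRate u a) z * onProd u' z ∂prodMeasure P T
          + 2 * (lam * (1 / M)) * ∫ z, onProd (u a) z * onProd u' z ∂prodMeasure P T)
        - 1 / ρd * ∫ z, (onProd (K a) z + onProd (timeInt (u a)) z) * W z ∂prodMeasure P T)
      = 1 / (M : ℝ) * (∫ ω, lsIntegral T (fun t => k t ω) (fun t => A t ω) ∂P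
          - lam * ∫ z, onProd (average u) z * onProd u' z ∂prodMeasure P T)
        - lam * (1 / M) * (1 / (M : ℝ) * ∫ z, onProd (u a) z * onProd u' z ∂prodMeasure P T)
        - 1 / ρd * (1 / (M : ℝ) *
          ∫ z, (onProd (K a) z + onProd (timeInt (u a)) z) * W z ∂prodMeasure P T) := by
    intro a
    rw [hsplit a]
    ring
  simp only [hterm] at hsum
  rw [Finset.sum_sub_distrib, Finset.sum_sub_distrib, ← Finset.sum_mul,
    ← Finset.mul_sum _ _ (lam * (1 / (M : ℝ))), ← Finset.mul_sum _ _ (1 / ρd), hone, hrate,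
    hexp] at hsum
  have hc : lam * ((M + 1) / (M : ℝ)) = lam + lam * (1 / M) := by field_simp
  rw [hc]
  linarith

/-! ### The equilibrium price -/

omit [IsProbabilityMeasure P] in
lemma IsDrift.integrable {A : ℝ≥0 → Ω → ℝ} [IsFiniteMeasure P] (hA : IsDrift P T A)
    (h0 : ∀ ω, A 0 ω = 0) {t : ℝ≥0} (ht : t ≤ T) : Integrable (A t) P := by
  refine ⟨(hA.measurable t).aestronglyMeasurable, ?_⟩
  have hle : ∀ ω, ‖A t ω‖ₑ ≤ (eVariationOn (fun t => A t ω) (Set.Icc 0 T)) ^ 2 + 1 := by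
    intro ω
    have h1 : ‖A t ω‖ₑ ≤ eVariationOn (fun t => A t ω) (Set.Icc 0 T) := by
      have := eVariationOn.edist_le (fun t => A t ω) (s := Set.Icc 0 T) (x := t) (y := 0)
        ⟨zero_le, ht⟩ ⟨le_rfl, zero_le⟩
      rwa [h0, edist_zero_right] at this
    refine h1.trans ?_
    set x := eVariationOn (fun t => A t ω) (Set.Icc 0 T)
    rcases le_total x 1 with h | h
    · exact h.trans le_add_self
    · calc x = x * 1 := (mul_one x).symm
        _ ≤ x * x := by gcongr
        _ = x ^ 2 := (pow_two x).symm
        _ ≤ _ := le_self_add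
  refine (lintegral_mono hle).trans_lt ?_
  rw [lintegral_add_right _ measurable_const, lintegral_one]
  exact ENNReal.add_lt_top.2 ⟨hA.sq, measure_lt_top _ _⟩

/-- The gap between the dividend and the price is the expected remaining drift of the price. -/
lemma expectedDividend_sub_price {DT : Ω → ℝ} {D S A : ℝ≥0 → Ω → ℝ}
    (hDT : MemLp DT 2 P) (hD : IsExpectedDividend P 𝓕 T DT D)
    (hS : IsH2WithDrift P 𝓕 T S A) (hST : S T =ᵐ[P] DT) {t : ℝ≥0} (ht : t ≤ T) :
    (fun ω => D t ω - S t ω) =ᵐ[P] P[fun ω => A T ω - A t ω|𝓕 t] := by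
  obtain ⟨hS0, ⟨N, hN, hN2, hN0, -, hdec⟩, hApred, hA0, -⟩ := id hS
  have hA := hS.isDrift
  have hAT := hA.integrable hA0 le_rfl
  have hAt := hA.integrable hA0 ht
  have hNT := hN.integrable T
  have hDTi : Integrable DT P := hDT.integrable (by norm_num)
  have hS0i : Integrable (S 0) P := by
    refine ((hDTi.sub hNT).sub hAT).congr ?_
    filter_upwards [hST, hdec] with ω h1 h2
    have := h2 T le_rfl
    simp only [Pi.sub_apply]
    linarith
  have e1 : DT =ᵐ[P] (S 0 + N T) + A T := by
    filter_upwards [hST, hdec] with ω h1 h2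
    have := h2 T le_rfl
    simp only [Pi.add_apply]
    linarith
  have e2 := condExp_congr_ae (m := 𝓕 t) e1
  have e3 := condExp_add (hS0i.add hNT) hAT (𝓕 t)
  have e4 := condExp_add hS0i hNT (𝓕 t)
  have e5 : P[S 0|𝓕 t] = S 0 :=
    condExp_of_stronglyMeasurable (𝓕.le t) (hS0.mono (𝓕.mono zero_le)) hS0i
  have e6 := hN.condExp_ae_eq ht
  have e7 := condExp_sub hAT hAt (𝓕 t)
  have e8 : P[A t|𝓕 t] = A t :=
    condExp_of_stronglyMeasurable (𝓕.le t) (hApred.stronglyAdapted t) hAt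
  have e9 : P[fun ω => A T ω - A t ω|𝓕 t] = P[A T - A t|𝓕 t] := rfl
  rw [e9]
  filter_upwards [hD.1 t ht, e2, e3, e4, e6, e7, hdec] with ω h1 h2 h3 h4 h6 h7 hdec
  have h9 := hdec t ht
  rw [e5] at h4
  rw [e8] at h7
  simp only [Pi.add_apply, Pi.sub_apply] at *
  linarith

omit [IsProbabilityMeasure P] in
lemma predictable_indicator_Ioi {t : ℝ≥0} {F : Set Ω} (hF : MeasurableSet[𝓕 t] F) :
    IsStronglyPredictable 𝓕 fun s ω =>
      (Set.Ioi t).indicator (fun _ => F.indicator (fun _ => (1 : ℝ)) ω) s := by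
  have h : (Function.uncurry fun s ω =>
      (Set.Ioi t).indicator (fun _ => F.indicator (fun _ => (1 : ℝ)) ω) s)
      = (Set.Ioi t ×ˢ F).indicator fun _ => 1 := by
    ext ⟨s, ω⟩
    by_cases h1 : s ∈ Set.Ioi t <;> by_cases h2 : ω ∈ F <;>
      simp_all [Function.uncurry, Set.indicator]
  rw [IsStronglyPredictable, h]
  exact (@stronglyMeasurable_const _ _ 𝓕.predictable _ (1 : ℝ)).indicator
    (measurableSet_predictable_Ioi_prod hF)

/-- If the drift satisfies the first-order condition `dA = ρ⁻¹ X dt` tested against predictable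
positions, the expected remaining drift is `ρ⁻¹ E[∫_t^T X ds | 𝓕_t]`. -/
lemma condExp_drift_eq {ρd : ℝ} {A X : ℝ≥0 → Ω → ℝ} (hA : IsDrift P T A) (hA0 : ∀ ω, A 0 ω = 0)
    (hX : IsSqInt P T X)
    (hfoc : ∀ k : ℝ≥0 → Ω → ℝ, IsStronglyPredictable 𝓕 k → (∀ t ω, |k t ω| ≤ 1) →
      ∫ ω, lsIntegral T (fun t => k t ω) (fun t => A t ω) ∂P
        = 1 / ρd * ∫ z, onProd X z * onProd k z ∂prodMeasure P T)
    {t : ℝ≥0} (ht : t ≤ T) :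
    P[fun ω => A T ω - A t ω|𝓕 t] =ᵐ[P] P[fun ω => 1 / ρd * tailInt T X t ω|𝓕 t] := by
  have hAi : Integrable (fun ω => A T ω - A t ω) P :=
    (hA.integrable hA0 le_rfl).sub (hA.integrable hA0 ht)
  have htail : Integrable (fun ω => 1 / ρd * tailInt T X t ω) P :=
    (((hX.memLp_timeInt_apply le_rfl).sub (hX.memLp_timeInt_apply ht)).integrable
      (by norm_num)).const_mul _
  refine ae_eq_condExp_of_forall_setIntegral_eq (𝓕.le t) htail
    (fun _ _ _ => integrable_condExp.integrableOn) (fun F hF _ => ?_)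
    stronglyMeasurable_condExp.aestronglyMeasurable
  have hF' := 𝓕.le t F hF
  rw [setIntegral_condExp (𝓕.le t) hAi hF]
  -- The test position holds one unit after time `t` on the event `F`.
  set k : ℝ≥0 → Ω → ℝ := fun s ω =>
    (Set.Ioi t).indicator (fun _ => F.indicator (fun _ => (1 : ℝ)) ω) s with hkdef
  have hk : IsStronglyPredictable 𝓕 k := predictable_indicator_Ioi hF
  have hk1 : ∀ t ω, |k t ω| ≤ 1 := by
    intro s ω
    simp only [hkdef, Set.indicator]
    split_ifs <;> simp
  have h := hfoc k hk hk1
  have hkL : MemLp (onProd k) 2 (prodMeasure P T) := (memS2_of_bounded hk hk1).memLp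
  rw [integral_prodMeasure (integrable_mul_of_memLp hX.memLp hkL), ← integral_const_mul] at h
  rw [← integral_indicator hF', ← integral_indicator hF']
  have h1 : ∀ ω, lsIntegral T (fun s => k s ω) (fun s => A s ω)
      = F.indicator (fun ω => A T ω - A t ω) ω := by
    intro ω
    rw [(hA.path ω).lsIntegral_indicator_Ioi ht]
    by_cases hω : ω ∈ F <;> simp [hω]
  simp only [h1] at h
  rw [h]
  refine integral_congr_ae ?_
  filter_upwards [hX.ae_integrable] with ω hω
  have h2 : ∀ s, onProd X (ω, s) * onProd k (ω, s)
      = F.indicator (fun _ => (1 : ℝ)) ω * (Set.Ioi t).indicator (fun s => X s ω) s := by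
    intro s
    by_cases hs : s ∈ Set.Ioi t <;> simp [onProd, hkdef, hs, mul_comm]
  have h3 : Set.Ioi t ∩ Set.Ioc 0 T = Set.Ioc t T := by
    ext s
    simp only [Set.mem_inter_iff, Set.mem_Ioi, Set.mem_Ioc]
    exact ⟨fun hs => ⟨hs.1, hs.2.2⟩, fun hs => ⟨hs.1, zero_le.trans_lt hs.1, hs.2⟩⟩
  simp only [h2]
  rw [integral_const_mul, integral_indicator measurableSet_Ioi, timeMeasure,
    Measure.restrict_restrict measurableSet_Ioi, h3, setIntegral_Ioc_sub hω ht le_rfl]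
  by_cases hω : ω ∈ F <;> simp [hω, tailInt, timeInt_eq]

/-! ### Predictable projection of a càdlàg process -/

/-- The predictable `σ`-algebra, transported to `Ω × ℝ≥0`. -/
abbrev predictableProd (𝓕 : Filtration ℝ≥0 mΩ) : MeasurableSpace (Ω × ℝ≥0) :=
  𝓕.predictable.comap Prod.swap

lemma predictableProd_le (𝓕 : Filtration ℝ≥0 mΩ) :
    predictableProd 𝓕 ≤ (inferInstance : MeasurableSpace (Ω × ℝ≥0)) := by
  rintro s ⟨F, hF, rfl⟩
  exact measurable_swap (predictable_le_prod 𝓕 F hF)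

lemma stronglyMeasurable_onProd {X : ℝ≥0 → Ω → ℝ} (hX : IsStronglyPredictable 𝓕 X) :
    StronglyMeasurable[predictableProd 𝓕] (onProd X) :=
  StronglyMeasurable.comp_measurable hX (comap_measurable Prod.swap)

lemma predictable_step (π : TimePartition T) {Y : ℝ≥0 → Ω → ℝ}
    (hY : ∀ t, StronglyMeasurable[𝓕 t] (Y t)) :
    IsStronglyPredictable 𝓕 fun s ω => π.step (fun i => Y (π.point i) ω) s := by
  have h : ∀ a b : ℝ≥0, Measurable[𝓕.predictable] fun z : ℝ≥0 × Ω =>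
      (Set.Ioc a b).indicator (fun _ => Y a z.2) z.1 := by
    intro a b B hB
    have hset : MeasurableSet[𝓕.predictable] (Set.Ioc a b ×ˢ (Y a ⁻¹' B)) :=
      measurableSet_predictable_Ioc_prod _ _ ((hY a).measurable hB)
    have hset' : MeasurableSet[𝓕.predictable] (Set.Ioc a b ×ˢ (Set.univ : Set Ω)) :=
      measurableSet_predictable_Ioc_prod _ _ MeasurableSet.univ
    by_cases h0 : (0 : ℝ) ∈ B
    · convert @MeasurableSet.union _ 𝓕.predictable _ _ hset hset'.compl using 1
      ext ⟨s, ω⟩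
      by_cases hs : s ∈ Set.Ioc a b
      · simp [hs, -Set.mem_Ioc]
      · simp [hs, h0, -Set.mem_Ioc]
    · convert hset using 1
      ext ⟨s, ω⟩
      by_cases hs : s ∈ Set.Ioc a b
      · simp [hs, -Set.mem_Ioc]
      · simp [hs, h0, -Set.mem_Ioc]
  have hsum : Measurable[𝓕.predictable] fun z : ℝ≥0 × Ω => ∑ i ∈ Finset.range π.n,
      (Set.Ioc (π.point i) (π.point (i + 1))).indicator (fun _ => Y (π.point i) z.2) z.1 :=
    @Finset.measurable_fun_sum _ _ _ _ _ _ 𝓕.predictable _ _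
      fun i _ => h (π.point i) (π.point (i + 1))
  exact hsum.stronglyMeasurable

lemma measurable_step_process (π : TimePartition T) {c : ℕ → Ω → ℝ} (hc : ∀ i, Measurable (c i)) :
    Measurable fun z : Ω × ℝ≥0 => π.step (fun i => c i z.1) z.2 := by
  refine Finset.measurable_fun_sum _ fun i _ => ?_
  exact ((hc i).comp measurable_fst).indicator
    (s := {z : Ω × ℝ≥0 | z.2 ∈ Set.Ioc (π.point i) (π.point (i + 1))})
    (measurable_snd measurableSet_Ioc)

omit [IsProbabilityMeasure P] in
/-- A process `Y` with almost surely càdlàg paths is, as a function of `(ω, t)`, measurable up to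
modification, and coincides `P ⊗ dt`-almost everywhere with the predictable process `Y₋` of its
left limits. -/
lemma exists_predictable_modification {Y ξ : ℝ≥0 → Ω → ℝ}
    (hYc : ∀ᵐ ω ∂P, IsCadlagOn T fun t => Y t ω) (hY : ∀ t ≤ T, Y t =ᵐ[P] P[ξ t|𝓕 t]) :
    ∃ G H : Ω × ℝ≥0 → ℝ, Measurable G ∧ StronglyMeasurable[predictableProd 𝓕] H ∧
      (∀ᵐ ω ∂P, ∀ s ∈ Set.Ioc 0 T, G (ω, s) = Y s ω) ∧ G =ᵐ[prodMeasure P T] H := by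
  set Y' : ℝ≥0 → Ω → ℝ := fun t => P[ξ t|𝓕 t] with hY'
  have hYm : ∀ t, StronglyMeasurable[𝓕 t] (Y' t) := fun t => stronglyMeasurable_condExp
  set π := fun n => TimePartition.uniform T n with hπdef
  have hπ : Tendsto (fun n => (π n).mesh) atTop (𝓝 0) := TimePartition.tendsto_mesh_uniform T
  set R : ℕ → Ω × ℝ≥0 → ℝ := fun n z =>
    (π n).step (fun i => Y' ((π n).point (i + 1)) z.1) z.2 with hR
  set L : ℕ → Ω × ℝ≥0 → ℝ := fun n =>
    onProd fun s ω => (π n).step (fun i => Y' ((π n).point i) ω) s with hL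
  -- The right-point samples `R n` converge to `Y` everywhere but anticipate; the left-point samples
  -- `L n` are predictable but converge to `Y` only outside the jump times.
  have hRm : ∀ n, Measurable (R n) := fun n =>
    measurable_step_process (π n) fun i => ((hYm _).mono (𝓕.le _)).measurable
  have hLm : ∀ n, StronglyMeasurable[predictableProd 𝓕] (L n) := fun n =>
    stronglyMeasurable_onProd (predictable_step (π n) hYm)
  have hG : Measurable fun z => limUnder atTop fun n => R n z :=
    (StronglyMeasurable.limUnder fun n => (hRm n).stronglyMeasurable).measurable
  have hH : StronglyMeasurable[predictableProd 𝓕] fun z => limUnder atTop fun n => L n z :=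
    @StronglyMeasurable.limUnder _ _ _ (predictableProd 𝓕) _ _ _ _ _ _ _ hLm
  have hpts : ∀ᵐ ω ∂P, ∀ n, ∀ i ≤ (π n).n, Y ((π n).point i) ω = Y' ((π n).point i) ω := by
    refine ae_all_iff.2 fun n => ae_all_iff.2 fun i => ?_
    by_cases hi : i ≤ (π n).n
    · filter_upwards [hY _ ((π n).point_le hi)] with ω hω _ using hω
    · exact .of_forall fun ω h => absurd h hi
  have hGY : ∀ᵐ ω ∂P, ∀ s ∈ Set.Ioc 0 T, (limUnder atTop fun n => R n (ω, s)) = Y s ω := by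
    filter_upwards [hYc, hpts] with ω hc hp s hs
    refine ((hc.tendsto_step_right hπ hs).congr fun n => ?_).limUnder_eq
    obtain ⟨i, hi, hsi⟩ := (π n).exists_mem_Ioc hs
    simp only [hR]
    rw [(π n).step_eq hi hsi, (π n).step_eq hi hsi, hp n (i + 1) hi]
  refine ⟨_, _, hG, hH, hGY, ?_⟩
  have hmeas : MeasurableSet {z : Ω × ℝ≥0 | (limUnder atTop fun n => R n z)
      = limUnder atTop fun n => L n z} :=
    measurableSet_eq_fun hG (hH.mono (predictableProd_le 𝓕)).measurable
  refine (Measure.ae_prod_mem_iff_ae_ae_mem hmeas).2 ?_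
  filter_upwards [hYc, hpts, hGY] with ω hc hp hg
  filter_upwards [ae_timeMeasure_mem T, hc.ae_tendsto_left] with s hs hl
  rw [hg s hs]
  have hl' : Tendsto (fun t => Y t ω) (𝓝[Set.Iio s ∩ Set.Icc 0 T] s) (𝓝 (Y s ω)) :=
    hl.mono_left (nhdsWithin_mono _ Set.inter_subset_left)
  refine ((tendsto_step_left hl' hπ hs).congr fun n => ?_).limUnder_eq.symm
  obtain ⟨i, hi, hsi⟩ := (π n).exists_mem_Ioc hs
  simp only [hL, onProd]
  rw [(π n).step_eq hi hsi, (π n).step_eq hi hsi, hp n i hi.le]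

/-- If `V` is predictable and `V + ξ` is orthogonal to all predictable processes, then `-V` is the
predictable projection of `ξ`; if moreover `Y_t = E[ξ_t | 𝓕_t]` has càdlàg paths, this
projection is `Y`. -/
lemma ae_add_eq_zero_of_orthogonal {Y ξ V : ℝ≥0 → Ω → ℝ}
    (hYc : ∀ᵐ ω ∂P, IsCadlagOn T fun t => Y t ω) (hY : ∀ t ≤ T, Y t =ᵐ[P] P[ξ t|𝓕 t])
    (hξ : IsSqInt P T ξ) (hV : MemL2 P 𝓕 T V)
    (horth : ∀ u' : ℝ≥0 → Ω → ℝ, MemL2 P 𝓕 T u' →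
      ∫ z, onProd u' z * (onProd V z + onProd ξ z) ∂prodMeasure P T = 0) :
    ∀ᵐ ω ∂P, ∀ᵐ s ∂timeMeasure T, V s ω + Y s ω = 0 := by
  obtain ⟨G, H, hG, hH, hGY, hGH⟩ := exists_predictable_modification hYc hY
  have hξi : Integrable (onProd ξ) (prodMeasure P T) := hξ.memLp.integrable (by norm_num)
  have hVi : Integrable (onProd V) (prodMeasure P T) := hV.memLp.integrable (by norm_num)
  have hGs : ∀ᵐ s ∂timeMeasure T, (fun ω => G (ω, s)) =ᵐ[P] P[ξ s|𝓕 s] := by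
    filter_upwards [ae_timeMeasure_mem T] with s hs
    filter_upwards [hGY, hY s hs.2] with ω h1 h2
    rw [h1 s hs, h2]
  have hξs : ∀ᵐ s ∂timeMeasure T, Integrable (ξ s) P := hξi.prod_left_ae
  have hGi : Integrable G (prodMeasure P T) := by
    refine (integrable_prod_iff' hG.aestronglyMeasurable).2 ⟨?_, ?_⟩
    · filter_upwards [hGs] with s hs using integrable_condExp.congr hs.symm
    · refine Integrable.mono' (g := fun s => ∫ ω, |ξ s ω| ∂P) hξi.abs.integral_prod_right
        (hG.norm.stronglyMeasurable.integral_prod_left).aestronglyMeasurable ?_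
      filter_upwards [hGs] with s hs
      rw [Real.norm_of_nonneg (integral_nonneg fun _ => norm_nonneg _)]
      calc ∫ ω, ‖G (ω, s)‖ ∂P = ∫ ω, |(P[ξ s|𝓕 s]) ω| ∂P := by
            refine integral_congr_ae ?_
            filter_upwards [hs] with ω hω
            rw [hω, Real.norm_eq_abs]
        _ ≤ _ := integral_abs_condExp_le _
  have hzero : (fun z => onProd V z + H z) =ᵐ[prodMeasure P T] fun _ => 0 := by
    have hHi : Integrable H (prodMeasure P T) := hGi.congr hGH
    refine ae_eq_of_forall_setIntegral_eq_of_sigmaFinite' (predictableProd_le 𝓕)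
      (fun _ _ _ => (hVi.add hHi).integrableOn) (fun _ _ _ => (integrable_zero _ _ _).integrableOn)
      ?_ ((stronglyMeasurable_onProd hV.1).add hH).aestronglyMeasurable
      stronglyMeasurable_const.aestronglyMeasurable
    rintro _ ⟨F, hF, rfl⟩ -
    set B : Set (Ω × ℝ≥0) := Prod.swap ⁻¹' F
    have hB : MeasurableSet B := predictableProd_le 𝓕 _ ⟨F, hF, rfl⟩
    set k : ℝ≥0 → Ω → ℝ := fun s ω => F.indicator (fun _ => 1) (s, ω) with hk
    have hkp : IsStronglyPredictable 𝓕 k :=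
      (@stronglyMeasurable_const _ _ 𝓕.predictable _ (1 : ℝ)).indicator hF
    have hkB : ∀ z, onProd k z = B.indicator (fun _ => 1) z := fun z => rfl
    have hkL : MemL2 P 𝓕 T k := (memS2_of_bounded hkp (C := 1) fun t ω => by
      simp only [hk, Set.indicator]; split_ifs <;> simp).memL2
    have hsec : ∀ s, MeasurableSet[𝓕 s] {ω | (s, ω) ∈ F} := by
      intro s
      have h1 := (hkp.stronglyAdapted s).measurable (measurableSet_singleton (1 : ℝ))
      convert h1 using 1
      ext ω
      by_cases h : (s, ω) ∈ F <;> simp [hk, h]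
    -- The sections of a predictable set are `𝓕 s`-measurable, so `ξ` and its conditional
    -- expectations have the same integral over it.
    have h1 : ∫ z in B, G z ∂prodMeasure P T = ∫ z in B, onProd ξ z ∂prodMeasure P T := by
      rw [← integral_indicator hB, ← integral_indicator hB]
      rw [prodMeasure, integral_prod_symm _ (hGi.indicator hB),
        integral_prod_symm _ (hξi.indicator hB)]
      refine integral_congr_ae ?_
      filter_upwards [hGs, hξs] with s hs hi
      have e : ∀ f : Ω × ℝ≥0 → ℝ, ∫ ω, B.indicator f (ω, s) ∂P
          = ∫ ω in {ω | (s, ω) ∈ F}, f (ω, s) ∂P := by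
        intro f
        rw [← integral_indicator (𝓕.le s _ (hsec s))]
        rfl
      rw [e, e]
      calc ∫ ω in {ω | (s, ω) ∈ F}, G (ω, s) ∂P
          = ∫ ω in {ω | (s, ω) ∈ F}, (P[ξ s|𝓕 s]) ω ∂P :=
            integral_congr_ae (ae_restrict_of_ae hs)
        _ = _ := setIntegral_condExp (𝓕.le s) hi (hsec s)
    have h2 : ∫ z in B, (onProd V z + onProd ξ z) ∂prodMeasure P T = 0 := by
      rw [← integral_indicator hB, ← horth k hkL]
      congr 1; ext z
      rw [hkB]
      by_cases hz : z ∈ B <;> simp [hz]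
    rw [integral_zero, ← h2, integral_add hVi.integrableOn hHi.integrableOn,
      integral_add hVi.integrableOn hξi.integrableOn, ← h1,
      integral_congr_ae (ae_restrict_of_ae hGH)]
  have hz : ∀ᵐ z ∂prodMeasure P T, onProd V z + G z = 0 := by
    filter_upwards [hzero, hGH] with z h1 h2
    rw [h2, h1]
  filter_upwards [Measure.ae_ae_of_ae_prod hz, hGY] with ω h1 h2
  filter_upwards [h1, ae_timeMeasure_mem T] with s h3 h4
  rw [← h2 s h4]
  exact h3

/-! ### Weak convergence of rates with small primitives -/

/-- The truncation of `x` to `[-m, m]`. -/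
def clamp (m x : ℝ) : ℝ := max (-m) (min m x)

lemma abs_clamp_le {m : ℝ} (hm : 0 ≤ m) (x : ℝ) : |clamp m x| ≤ m :=
  abs_le.2 ⟨le_max_left _ _, max_le (by linarith) (min_le_left _ _)⟩

lemma clamp_eq {m x : ℝ} (h : |x| ≤ m) : clamp m x = x := by
  rw [clamp, min_eq_right (abs_le.1 h).2, max_eq_right (abs_le.1 h).1]

lemma abs_sub_clamp_le {m : ℝ} (hm : 0 ≤ m) (x : ℝ) : |x - clamp m x| ≤ |x| := by
  rcases le_total |x| m with h | h
  · simp [clamp_eq h]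
  · rw [clamp]
    rcases le_total 0 x with hx | hx
    · rw [abs_of_nonneg hx] at h ⊢
      rw [min_eq_left h, max_eq_right (by linarith), abs_of_nonneg (by linarith)]
      linarith
    · rw [abs_of_nonpos hx] at h ⊢
      rw [min_eq_right (by linarith), max_eq_left (by linarith), abs_of_nonpos (by linarith)]
      linarith

lemma continuous_clamp (m : ℝ) : Continuous (clamp m) := by
  unfold clamp
  fun_prop

/-- Processes with continuous paths are approximated in `L²(P ⊗ dt)` by bounded step processes. -/
lemma exists_step_approx {μ : ℝ≥0 → Ω → ℝ} (hμ : IsSqInt P T μ)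
    (hc : ∀ᵐ ω ∂P, ContinuousOn (fun t => μ t ω) (Set.Icc 0 T)) {δ : ℝ} (hδ : 0 < δ) :
    ∃ (π : TimePartition T) (m : ℝ) (c : ℕ → Ω → ℝ), (∀ i, Measurable (c i)) ∧
      (∀ i ω, |c i ω| ≤ m) ∧
      ∫ z, (onProd μ z - π.step (fun i => c i z.1) z.2) ^ 2 ∂prodMeasure P T ≤ δ := by
  -- The truncation errors are dominated by `μ ^ 2`, hence tend to zero as the level increases.
  have h1 : Tendsto (fun m : ℕ => ∫ z, (onProd μ z - clamp m (onProd μ z)) ^ 2 ∂prodMeasure P T)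
      atTop (𝓝 (∫ _, (0 : ℝ) ∂prodMeasure P T)) := by
    refine tendsto_integral_of_dominated_convergence (fun z => onProd μ z ^ 2)
      (fun m => ((hμ.measurable.sub ((continuous_clamp m).measurable.comp
        hμ.measurable)).pow_const 2).aestronglyMeasurable) hμ.memLp.integrable_sq ?_ ?_
    · intro m
      refine .of_forall fun z => ?_
      rw [Real.norm_of_nonneg (sq_nonneg _)]
      exact sq_le_sq.2 (abs_sub_clamp_le m.cast_nonneg _)
    · refine .of_forall fun z => tendsto_const_nhds.congr' ?_
      obtain ⟨n, hn⟩ := exists_nat_ge |onProd μ z|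
      filter_upwards [eventually_ge_atTop n] with m hm
      rw [clamp_eq (hn.trans (Nat.cast_le.2 hm)), sub_self, zero_pow two_ne_zero]
  rw [integral_zero] at h1
  obtain ⟨m, hm⟩ := (h1.eventually (gt_mem_nhds (show (0 : ℝ) < δ / 4 by positivity))).exists
  set π := fun n => TimePartition.uniform T n with hπdef
  have hπ : Tendsto (fun n => (π n).mesh) atTop (𝓝 0) := TimePartition.tendsto_mesh_uniform T
  -- For fixed truncation level, dominated convergence as the partitions refine.
  set c : ℕ → ℕ → Ω → ℝ := fun n i ω => clamp m (μ ((π n).point i) ω) with hcdef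
  have hcm : ∀ n i, Measurable (c n i) := fun n i =>
    (continuous_clamp m).measurable.comp (hμ.measurable.comp measurable_prodMk_right)
  have hcb : ∀ n i ω, |c n i ω| ≤ m := fun n i ω => abs_clamp_le m.cast_nonneg _
  set φ : ℕ → Ω × ℝ≥0 → ℝ := fun n z => (π n).step (fun i => c n i z.1) z.2 with hφ
  have hφm : ∀ n, Measurable (φ n) := fun n => measurable_step_process (π n) (hcm n)
  have hcl : Measurable fun z => clamp m (onProd μ z) :=
    (continuous_clamp m).measurable.comp hμ.measurable
  have hT : ∀ᵐ z ∂prodMeasure P T, z.2 ∈ Set.Ioc 0 T :=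
    Measure.quasiMeasurePreserving_snd.ae (ae_timeMeasure_mem T)
  have hcc : ∀ᵐ z ∂prodMeasure P T, ContinuousOn (fun t => μ t z.1) (Set.Icc 0 T) :=
    Measure.quasiMeasurePreserving_fst.ae hc
  have hφb : ∀ n, ∀ᵐ z ∂prodMeasure P T, (clamp m (onProd μ z) - φ n z) ^ 2 ≤ (2 * m) ^ 2 := by
    intro n
    filter_upwards [hT] with z hz
    refine sq_le_sq.2 ?_
    have e1 := (π n).abs_step_le (c := fun i => c n i z.1) (fun i _ => hcb n i z.1) hz
    have e2 := abs_clamp_le m.cast_nonneg (onProd μ z)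
    calc |clamp m (onProd μ z) - φ n z| ≤ |clamp m (onProd μ z)| + |φ n z| := abs_sub _ _
      _ ≤ m + m := add_le_add e2 e1
      _ = |2 * (m : ℝ)| := by rw [abs_of_nonneg (by positivity)]; ring
  have h2 : Tendsto (fun n => ∫ z, (clamp m (onProd μ z) - φ n z) ^ 2 ∂prodMeasure P T)
      atTop (𝓝 (∫ _, (0 : ℝ) ∂prodMeasure P T)) := by
    refine tendsto_integral_of_dominated_convergence (fun z => (2 * (m : ℝ)) ^ 2)
      (fun n => ((hcl.sub (hφm n)).pow_const 2).aestronglyMeasurable) (integrable_const _) ?_ ?_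
    · intro n
      filter_upwards [hφb n] with z hz
      rwa [Real.norm_of_nonneg (sq_nonneg _)]
    · filter_upwards [hT, hcc] with z hz hz'
      have e1 : Tendsto (fun t => clamp m (μ t z.1)) (𝓝[Set.Iio z.2 ∩ Set.Icc 0 T] z.2)
          (𝓝 (clamp m (μ z.2 z.1))) :=
        ((continuous_clamp m).tendsto _).comp
          (((hz' z.2 ⟨hz.1.le, hz.2⟩).mono Set.inter_subset_right))
      have e2 := tendsto_step_left e1 hπ hz
      have e3 := (tendsto_const_nhds (x := clamp m (μ z.2 z.1))).sub e2
      simpa [hφ, hcdef, onProd] using e3.pow 2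
  rw [integral_zero] at h2
  obtain ⟨n, hn⟩ := (h2.eventually (gt_mem_nhds (show (0 : ℝ) < δ / 4 by positivity))).exists
  refine ⟨π n, m, c n, hcm n, hcb n, ?_⟩
  have i1 : Integrable (fun z => (onProd μ z - clamp m (onProd μ z)) ^ 2) (prodMeasure P T) := by
    refine hμ.memLp.integrable_sq.mono
      ((hμ.measurable.sub hcl).pow_const 2).aestronglyMeasurable (.of_forall fun z => ?_)
    rw [Real.norm_of_nonneg (sq_nonneg _), Real.norm_of_nonneg (sq_nonneg _)]
    exact sq_le_sq.2 (abs_sub_clamp_le m.cast_nonneg _)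
  have i2 : Integrable (fun z => (clamp m (onProd μ z) - φ n z) ^ 2) (prodMeasure P T) := by
    refine (integrable_const ((2 * (m : ℝ)) ^ 2)).mono'
      ((hcl.sub (hφm n)).pow_const 2).aestronglyMeasurable ?_
    filter_upwards [hφb n] with z hz
    rwa [Real.norm_of_nonneg (sq_nonneg _)]
  calc ∫ z, (onProd μ z - φ n z) ^ 2 ∂prodMeasure P T
      ≤ ∫ z, (2 * (onProd μ z - clamp m (onProd μ z)) ^ 2
          + 2 * (clamp m (onProd μ z) - φ n z) ^ 2) ∂prodMeasure P T := by
        refine integral_mono_of_nonneg (.of_forall fun z => sq_nonneg _)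
          ((i1.const_mul 2).add (i2.const_mul 2)) (.of_forall fun z => ?_)
        have := add_sq_le (a := onProd μ z - clamp m (onProd μ z))
          (b := clamp m (onProd μ z) - φ n z)
        simp only [sub_add_sub_cancel] at this
        linarith
    _ = 2 * ∫ z, (onProd μ z - clamp m (onProd μ z)) ^ 2 ∂prodMeasure P T
          + 2 * ∫ z, (clamp m (onProd μ z) - φ n z) ^ 2 ∂prodMeasure P T := by
        rw [integral_add (i1.const_mul 2) (i2.const_mul 2), integral_const_mul, integral_const_mul]
    _ ≤ δ := by linarith

lemma memLp_step_process (π : TimePartition T) {m : ℝ} {c : ℕ → Ω → ℝ}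
    (hcm : ∀ i, Measurable (c i)) (hcb : ∀ i ω, |c i ω| ≤ m) :
    MemLp (fun z : Ω × ℝ≥0 => π.step (fun i => c i z.1) z.2) 2 (prodMeasure P T) := by
  have hT : ∀ᵐ z ∂prodMeasure P T, z.2 ∈ Set.Ioc 0 T :=
    Measure.quasiMeasurePreserving_snd.ae (ae_timeMeasure_mem T)
  refine MemLp.of_bound (measurable_step_process π hcm).aestronglyMeasurable m ?_
  filter_upwards [hT] with z hz
  exact π.abs_step_le (fun i _ => hcb i z.1) hz

lemma integral_abs_le_of_sq_le {f : Ω → ℝ} (hf : MemLp f 2 P) {b : ℝ} (hb : 0 ≤ b)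
    (h : ∫ ω, f ω ^ 2 ∂P ≤ b ^ 2) : ∫ ω, |f ω| ∂P ≤ b := by
  have := abs_integral_mul_le hf (memLp_const (1 : ℝ))
  simp only [mul_one, one_pow, integral_const, probReal_univ, smul_eq_mul, Real.sqrt_one] at this
  exact this.trans (Real.sqrt_le_iff.2 ⟨hb, h⟩)

/-- Against a bounded step process, a rate is controlled by its primitive. -/
lemma abs_integral_step_mul_le (π : TimePartition T) {m : ℝ} {c : ℕ → Ω → ℝ}
    (hcm : ∀ i, Measurable (c i)) (hcb : ∀ i ω, |c i ω| ≤ m) {w : ℝ≥0 → Ω → ℝ}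
    (hw : IsSqInt P T w) {b : ℝ} (hb : 0 ≤ b)
    (h : ∀ t ≤ T, ∫ ω, (timeInt w t ω) ^ 2 ∂P ≤ b ^ 2) :
    |∫ z, π.step (fun i => c i z.1) z.2 * onProd w z ∂prodMeasure P T| ≤ π.n * (m * (2 * b)) := by
  have hm : 0 ≤ m := by
    obtain ⟨ω⟩ : Nonempty Ω := nonempty_of_isProbabilityMeasure P
    exact (abs_nonneg _).trans (hcb 0 ω)
  have hφ := memLp_step_process (P := P) π hcm hcb
  have habs : ∀ t ≤ T, Integrable (fun ω => |timeInt w t ω|) P := fun t ht =>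
    ((hw.memLp_timeInt_apply ht).integrable (by norm_num)).abs
  have hE : ∀ t ≤ T, ∫ ω, |timeInt w t ω| ∂P ≤ b := fun t ht =>
    integral_abs_le_of_sq_le (hw.memLp_timeInt_apply ht) hb (h t ht)
  rw [integral_prodMeasure (integrable_mul_of_memLp hφ hw.memLp)]
  have hin : ∀ i ∈ Finset.range π.n, Integrable (fun ω => m * (|timeInt w (π.point (i + 1)) ω|
      + |timeInt w (π.point i) ω|)) P := fun i hi =>
    ((habs _ (π.point_le (Finset.mem_range.1 hi))).add
      (habs _ (π.point_le (Finset.mem_range.1 hi).le))).const_mul m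
  calc |∫ ω, ∫ s, π.step (fun i => c i ω) s * w s ω ∂timeMeasure T ∂P|
      ≤ ∫ ω, ∑ i ∈ Finset.range π.n, m * (|timeInt w (π.point (i + 1)) ω|
          + |timeInt w (π.point i) ω|) ∂P := by
        rw [← Real.norm_eq_abs]
        refine norm_integral_le_of_norm_le (integrable_finsetSum _ hin) ?_
        filter_upwards [hw.ae_integrable] with ω hω
        rw [π.integral_step_mul _ hω, Real.norm_eq_abs]
        refine (Finset.abs_sum_le_sum_abs _ _).trans (Finset.sum_le_sum fun i hi => ?_)
        rw [setIntegral_Ioc_sub hω (π.mono (Nat.le_succ i))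
          (π.point_le (Finset.mem_range.1 hi)), ← timeInt_eq, ← timeInt_eq, abs_mul]
        exact mul_le_mul (hcb i ω) (abs_sub _ _) (abs_nonneg _) hm
    _ = ∑ i ∈ Finset.range π.n, m * (∫ ω, |timeInt w (π.point (i + 1)) ω| ∂P
          + ∫ ω, |timeInt w (π.point i) ω| ∂P) := by
        rw [integral_finsetSum _ hin]
        refine Finset.sum_congr rfl fun i hi => ?_
        rw [integral_const_mul, integral_add (habs _ (π.point_le (Finset.mem_range.1 hi)))
          (habs _ (π.point_le (Finset.mem_range.1 hi).le))]
    _ ≤ ∑ _i ∈ Finset.range π.n, m * (2 * b) := by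
        refine Finset.sum_le_sum fun i hi => mul_le_mul_of_nonneg_left ?_ hm
        linarith [hE _ (π.point_le (Finset.mem_range.1 hi)),
          hE _ (π.point_le (Finset.mem_range.1 hi).le)]
    _ = π.n * (m * (2 * b)) := by simp

/-- Rates which are bounded in `L²` and whose primitives are small converge weakly to zero,
uniformly. -/
lemma exists_weak_bound {μ : ℝ≥0 → Ω → ℝ} (hμ : IsSqInt P T μ)
    (hc : ∀ᵐ ω ∂P, ContinuousOn (fun t => μ t ω) (Set.Icc 0 T)) (N : ℝ) {η : ℝ} (hη : 0 < η) :
    ∃ C : ℝ, 0 ≤ C ∧ ∀ (w : ℝ≥0 → Ω → ℝ) (b : ℝ), IsSqInt P T w →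
      ∫ z, onProd w z ^ 2 ∂prodMeasure P T ≤ N → 0 ≤ b →
      (∀ t ≤ T, ∫ ω, (timeInt w t ω) ^ 2 ∂P ≤ b ^ 2) →
      |∫ z, onProd μ z * onProd w z ∂prodMeasure P T| ≤ η + C * b := by
  have hδ : 0 < (η / (√N + 1)) ^ 2 := by positivity
  obtain ⟨π, m, c, hcm, hcb, hle⟩ := exists_step_approx hμ hc hδ
  have hm : 0 ≤ m := by
    obtain ⟨ω⟩ : Nonempty Ω := nonempty_of_isProbabilityMeasure P
    exact (abs_nonneg _).trans (hcb 0 ω)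
  refine ⟨π.n * (m * 2), by positivity, fun w b hw hN hb h => ?_⟩
  have hφ := memLp_step_process (P := P) π hcm hcb
  have h1 := abs_integral_step_mul_le π hcm hcb hw hb h
  have h2 := abs_integral_le_sqrt (hμ.memLp.sub hφ) hw.memLp
  simp only [Pi.sub_apply] at h2
  have h3 : ∫ z, onProd μ z * onProd w z ∂prodMeasure P T
      = ∫ z, (onProd μ z - π.step (fun i => c i z.1) z.2) * onProd w z ∂prodMeasure P T
        + ∫ z, π.step (fun i => c i z.1) z.2 * onProd w z ∂prodMeasure P T := by
    have hi := integrable_mul_of_memLp (hμ.memLp.sub hφ) hw.memLp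
    simp only [Pi.sub_apply] at hi
    rw [← integral_add hi (integrable_mul_of_memLp hφ hw.memLp)]
    congr 1; ext z
    ring
  have h4 : √(∫ z, (onProd μ z - π.step (fun i => c i z.1) z.2) ^ 2 ∂prodMeasure P T)
      ≤ η / (√N + 1) := Real.sqrt_le_iff.2 ⟨by positivity, hle⟩
  have h5 : √(∫ z, onProd w z ^ 2 ∂prodMeasure P T) ≤ √N := Real.sqrt_le_sqrt hN
  have h6 : η / (√N + 1) * √N ≤ η := by
    rw [div_mul_eq_mul_div, div_le_iff₀ (by positivity)]
    nlinarith [Real.sqrt_nonneg N]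
  have h7 := mul_le_mul h4 h5 (Real.sqrt_nonneg _) (by positivity)
  rw [h3]
  calc _ ≤ _ := abs_add_le _ _
    _ ≤ η + π.n * (m * (2 * b)) := add_le_add ((h2.trans h7).trans h6) h1
    _ = _ := by ring

/-! ### Equilibrium prices and rates -/

omit [IsProbabilityMeasure P] in
lemma IsH2WithDrift.ae_isCadlagOn {S A : ℝ≥0 → Ω → ℝ} (h : IsH2WithDrift P 𝓕 T S A) :
    ∀ᵐ ω ∂P, IsCadlagOn T fun t => S t ω := by
  obtain ⟨-, ⟨N, -, -, -, hN, hdec⟩, -, -, hA, -⟩ := h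
  filter_upwards [hdec] with ω hω
  exact (((isCadlagOn_const T (S 0 ω)).add (hN ω)).add (hA ω)).congr hω

omit [IsProbabilityMeasure P] in
lemma IsH2WithDrift.aestronglyMeasurable {S A : ℝ≥0 → Ω → ℝ} (h : IsH2WithDrift P 𝓕 T S A)
    {t : ℝ≥0} (ht : t ≤ T) : AEStronglyMeasurable (S t) P := by
  have hAt := (h.isDrift.measurable t).aestronglyMeasurable (μ := P)
  obtain ⟨h0, ⟨N, hN, -, -, -, hdec⟩, -⟩ := h
  refine AEStronglyMeasurable.congr (((h0.mono (𝓕.le 0)).aestronglyMeasurable.add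
    ((hN.stronglyMeasurable t).mono (𝓕.le t)).aestronglyMeasurable).add hAt) ?_
  filter_upwards [hdec] with ω hω
  rw [hω t ht]
  rfl

section Equilibrium

variable {M : ℕ} {ρd lam : ℝ} {DT : Ω → ℝ} {D KN μN S : ℝ≥0 → Ω → ℝ}
  {K u : Fin M → ℝ≥0 → Ω → ℝ}

/-- The first-order condition for the average rate: marginal impact costs balance the marginal
inventory costs of the aggregate exposure `∫₀ᵗ (ū - μN) ds`. -/
lemma IsEquilibrium.rate_firstOrder (hM : 1 ≤ M) (hμ : MemL2 P 𝓕 T μN)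
    (hKN : ∀ᵐ ω ∂P, ∀ t ≤ T, KN t ω = timeInt μN t ω)
    (hE : IsEquilibrium P 𝓕 T DT (dealers Ω M ρd) lam KN S K u) {u' : ℝ≥0 → Ω → ℝ}
    (hu' : MemL2 P 𝓕 T u') :
    lam * ((M + 1) / M) * ∫ z, onProd (average u) z * onProd u' z ∂prodMeasure P T
      + 1 / ρd * ∫ z, onProd (timeInt fun t ω => average u t ω - μN t ω) z
          * onProd (timeInt u') z ∂prodMeasure P T = 0 := by
  obtain ⟨-, hadm, hclear, A, hS, hopt⟩ := hE
  have h0 := predictable_zero 𝓕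
  have h := aggregate_firstOrder hM hS.isDrift hμ hKN (fun a => (hadm a).1) (fun a => (hadm a).2)
    hclear hopt h0 (C := 0) (fun _ _ => by simp) hu'
  have hls : ∀ ω, lsIntegral T (fun _ => 0) (fun t => A t ω) = 0 := by
    intro ω
    have := (hS.isDrift.path ω).lsIntegral_indicator_Ioi le_rfl 0
    simpa using this
  simp only [hls, integral_zero, onProd, zero_add] at h
  simp only [onProd]
  linarith

/-- In equilibrium the price discount `D - S` offsets the dealers' marginal impact costs. -/
lemma IsEquilibrium.ae_rate_eq (hDT : MemLp DT 2 P) (hD : IsExpectedDividend P 𝓕 T DT D)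
    (hM : 1 ≤ M) (hμ : MemL2 P 𝓕 T μN) (hKN : ∀ᵐ ω ∂P, ∀ t ≤ T, KN t ω = timeInt μN t ω)
    (hE : IsEquilibrium P 𝓕 T DT (dealers Ω M ρd) lam KN S K u) :
    ∀ᵐ ω ∂P, ∀ᵐ s ∂timeMeasure T,
      lam * ((M + 1) / M) * average u s ω + (D s ω - S s ω) = 0 := by
  obtain ⟨hST, hadm, hclear, A, hS, hopt⟩ := id hE
  have hū := memL2_average fun a => (hadm a).2
  set w : ℝ≥0 → Ω → ℝ := fun t ω => average u t ω - μN t ω with hw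
  have hX : IsSqInt P T (timeInt w) := (hū.sub hμ).sqInt.primitive
  have h0 : MemL2 P 𝓕 T fun _ _ => (0 : ℝ) :=
    (memS2_of_bounded (predictable_zero 𝓕) (C := 0) (by simp)).memL2
  have hfoc : ∀ k : ℝ≥0 → Ω → ℝ, IsStronglyPredictable 𝓕 k → (∀ t ω, |k t ω| ≤ 1) →
      ∫ ω, lsIntegral T (fun t => k t ω) (fun t => A t ω) ∂P
        = 1 / ρd * ∫ z, onProd (timeInt w) z * onProd k z ∂prodMeasure P T := by
    intro k hk hk1
    have h := aggregate_firstOrder hM hS.isDrift hμ hKN (fun a => (hadm a).1)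
      (fun a => (hadm a).2) hclear hopt hk hk1 h0
    have hz : ∀ t (ω : Ω), timeInt (fun _ _ => (0 : ℝ)) t ω = 0 := fun t ω => by simp [timeInt]
    simp only [onProd, hz, mul_zero, integral_zero, sub_zero, add_zero] at h
    simp only [onProd]
    linarith
  set ξ : ℝ≥0 → Ω → ℝ := fun t ω => 1 / ρd * tailInt T (timeInt w) t ω with hξ
  have hξi : IsSqInt P T ξ := ⟨hX.tail.measurable.const_mul _, hX.tail.memLp.const_mul _⟩
  have hY : ∀ t ≤ T, (fun ω => D t ω - S t ω) =ᵐ[P] P[ξ t|𝓕 t] := fun t ht =>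
    (expectedDividend_sub_price hDT hD hS hST ht).trans
      (condExp_drift_eq hS.isDrift hS.2.2.2.1 hX hfoc ht)
  have hYc : ∀ᵐ ω ∂P, IsCadlagOn T fun t => D t ω - S t ω := by
    filter_upwards [hD.2, hS.ae_isCadlagOn] with ω h1 h2
    simpa only [sub_eq_add_neg] using h1.add h2.neg
  refine ae_add_eq_zero_of_orthogonal (Y := fun t ω => D t ω - S t ω) (ξ := ξ)
    (V := fun t ω => lam * ((M + 1) / M) * average u t ω) hYc hY hξi (hū.const_mul _) ?_
  intro u' hu'
  rw [← hE.rate_firstOrder hM hμ hKN hu', integral_timeInt_mul hX hu'.sqInt,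
    ← integral_const_mul, ← integral_const_mul,
    ← integral_add ((integrable_mul_of_memLp hū.memLp hu'.memLp).const_mul _)
      ((integrable_mul_of_memLp hu'.memLp hX.memLp_tailInt).const_mul _)]
  congr 1; ext z
  simp only [onProd, hξ]
  ring

omit [IsProbabilityMeasure P] in
lemma IsExpectedDividend.aestronglyMeasurable (hD : IsExpectedDividend P 𝓕 T DT D)
    {t : ℝ≥0} (ht : t ≤ T) : AEStronglyMeasurable (D t) P :=
  (integrable_condExp.aestronglyMeasurable).congr (hD.1 t ht).symm

omit [IsProbabilityMeasure P] in
lemma aestronglyMeasurable_demand (hμ : MemL2 P 𝓕 T μN)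
    (hKN : ∀ᵐ ω ∂P, ∀ t ≤ T, KN t ω = timeInt μN t ω) {t : ℝ≥0} (ht : t ≤ T) :
    AEStronglyMeasurable (KN t) P := by
  refine (measurable_timeInt_apply hμ.measurable t).aestronglyMeasurable.congr ?_
  filter_upwards [hKN] with ω hω using (hω t ht).symm

/-- The noise traders' liquidity costs are `λ (M + 1) / M ∫₀ᵀ ū μN dt`, because `D - S` vanishes at
time `T` and offsets the marginal impact costs before. -/
lemma IsEquilibrium.ae_liquidityCost_eq (hDTm : StronglyMeasurable[𝓕 T] DT) (hDT : MemLp DT 2 P)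
    (hD : IsExpectedDividend P 𝓕 T DT D)
    (hM : 1 ≤ M) (hμ : MemL2 P 𝓕 T μN) (hKN : ∀ᵐ ω ∂P, ∀ t ≤ T, KN t ω = timeInt μN t ω)
    (hE : IsEquilibrium P 𝓕 T DT (dealers Ω M ρd) lam KN S K u) {ID IS : Ω → ℝ}
    (hID : IsStochasticIntegral P T KN D ID) (hIS : IsStochasticIntegral P T KN S IS) :
    ∀ᵐ ω ∂P, ID ω - IS ω
      = lam * ((M + 1) / M) * ∫ s, average u s ω * μN s ω ∂timeMeasure T := by
  have hrate := hE.ae_rate_eq hDT hD hM hμ hKN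
  obtain ⟨hST, -, -, A, hS, -⟩ := hE
  have hKm := fun t (ht : t ≤ T) => aestronglyMeasurable_demand hμ hKN ht
  have hμi := hμ.sqInt.ae_integrable
  have hDc := hD.2
  have hSc := hS.ae_isCadlagOn
  -- Both `D` and `S` end at the dividend, so the boundary term of the partial integration vanishes.
  have hDT' : D T =ᵐ[P] DT := by
    have := hD.1 T le_rfl
    rwa [condExp_of_stronglyMeasurable (𝓕.le T) hDTm (hDT.integrable (by norm_num))] at this
  have hπ := TimePartition.tendsto_mesh_uniform T
  filter_upwards [hID.ae_eq (isStochasticIntegral_of_cadlag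
      (fun t ht => hD.aestronglyMeasurable ht) hKm hDc hμi hKN),
    hIS.ae_eq (isStochasticIntegral_of_cadlag
      (fun t ht => hS.aestronglyMeasurable ht) hKm hSc hμi hKN),
    hDc, hSc, hμi, hKN, hDT', hST, hrate] with ω h1 h2 h3 h4 h5 h6 h7 h8 h9
  have hY : IsCadlagOn T fun t => D t ω - S t ω := by
    simpa only [sub_eq_add_neg] using h3.add h4.neg
  have l1 := (tendsto_itoSum h3 h5 h6 hπ).sub (tendsto_itoSum h4 h5 h6 hπ)
  have l2 := tendsto_itoSum (Y := fun t ω => D t ω - S t ω) hY h5 h6 hπ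
  have hsub : ∀ j, itoSum KN D (TimePartition.uniform T j) ω
      - itoSum KN S (TimePartition.uniform T j) ω
      = itoSum KN (fun t ω => D t ω - S t ω) (TimePartition.uniform T j) ω := by
    intro j
    simp only [itoSum]
    rw [← Finset.sum_sub_distrib]
    exact Finset.sum_congr rfl fun i _ => by ring
  rw [h1, h2, tendsto_nhds_unique (l1.congr hsub) l2, h7, h8, sub_self, mul_zero, zero_sub,
    ← integral_neg, ← integral_const_mul]
  refine integral_congr_ae ?_
  filter_upwards [h9] with s hs
  linear_combination μN s ω * (-1 : ℝ) * hs

end Equilibrium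

/-! ### Asymptotics -/

omit [IsProbabilityMeasure P] in
/-- A priori bounds from the energy identity `κ ⟨w + μ, w⟩ + ‖∫ w‖² = 0`. -/
lemma energy_bounds {w μ : ℝ≥0 → Ω → ℝ} (hw : IsSqInt P T w) (hμ : IsSqInt P T μ) {κ : ℝ}
    (hκ : 0 < κ)
    (h : κ * ∫ z, (onProd w z + onProd μ z) * onProd w z ∂prodMeasure P T
      + ∫ z, onProd (timeInt w) z ^ 2 ∂prodMeasure P T = 0) :
    ∫ z, onProd w z ^ 2 ∂prodMeasure P T ≤ |∫ z, onProd μ z * onProd w z ∂prodMeasure P T| ∧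
    ∫ z, onProd w z ^ 2 ∂prodMeasure P T ≤ ∫ z, onProd μ z ^ 2 ∂prodMeasure P T ∧
    ∫ z, onProd (timeInt w) z ^ 2 ∂prodMeasure P T
      ≤ κ * ∫ z, onProd μ z ^ 2 ∂prodMeasure P T := by
  have hsplit : ∫ z, (onProd w z + onProd μ z) * onProd w z ∂prodMeasure P T
      = ∫ z, onProd w z ^ 2 ∂prodMeasure P T
        + ∫ z, onProd μ z * onProd w z ∂prodMeasure P T := by
    rw [← integral_add hw.memLp.integrable_sq (integrable_mul_of_memLp hμ.memLp hw.memLp)]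
    congr 1; ext z; ring
  have hcs := abs_integral_le_sqrt hμ.memLp hw.memLp
  have hQ : 0 ≤ ∫ z, onProd (timeInt w) z ^ 2 ∂prodMeasure P T :=
    integral_nonneg fun z => sq_nonneg _
  have hW : 0 ≤ ∫ z, onProd w z ^ 2 ∂prodMeasure P T := integral_nonneg fun z => sq_nonneg _
  have hN : 0 ≤ ∫ z, onProd μ z ^ 2 ∂prodMeasure P T := integral_nonneg fun z => sq_nonneg _
  rw [hsplit] at h
  set W := ∫ z, onProd w z ^ 2 ∂prodMeasure P T
  set N := ∫ z, onProd μ z ^ 2 ∂prodMeasure P T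
  set m := ∫ z, onProd μ z * onProd w z ∂prodMeasure P T
  set Q := ∫ z, onProd (timeInt w) z ^ 2 ∂prodMeasure P T
  have h1 : W ≤ -m := by
    by_contra! hlt
    have : 0 < κ * (W + m) := mul_pos hκ (by linarith)
    linarith
  have h2 : W ≤ |m| := h1.trans (neg_le_abs m)
  have ha := Real.sq_sqrt hW
  have hb := Real.sq_sqrt hN
  have ha0 := Real.sqrt_nonneg W
  have hb0 := Real.sqrt_nonneg N
  have h3 : √W ≤ √N := by
    by_contra! hlt
    nlinarith
  have h4 : |m| ≤ N := by nlinarith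
  refine ⟨h2, h2.trans h4, ?_⟩
  have h5 : κ * (-m) ≤ κ * N := mul_le_mul_of_nonneg_left ((neg_le_abs m).trans h4) hκ.le
  have h6 : 0 ≤ κ * W := by positivity
  linarith

/-- As `κ → 0`, the solutions `w` of the energy identity tend to `0` in `L²`. -/
lemma exists_energy_small {μ : ℝ≥0 → Ω → ℝ} (hμ : IsSqInt P T μ)
    (hc : ∀ᵐ ω ∂P, ContinuousOn (fun t => μ t ω) (Set.Icc 0 T)) {η : ℝ} (hη : 0 < η) :
    ∃ κ₀ : ℝ, 0 < κ₀ ∧ ∀ (κ : ℝ) (w : ℝ≥0 → Ω → ℝ), 0 < κ → κ < κ₀ → IsSqInt P T w →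
      κ * ∫ z, (onProd w z + onProd μ z) * onProd w z ∂prodMeasure P T
        + ∫ z, onProd (timeInt w) z ^ 2 ∂prodMeasure P T = 0 →
      ∫ z, onProd w z ^ 2 ∂prodMeasure P T ≤ η := by
  set N := ∫ z, onProd μ z ^ 2 ∂prodMeasure P T with hN
  obtain ⟨C, hC0, hC⟩ := exists_weak_bound hμ hc N (half_pos hη)
  have hcont : Continuous fun κ : ℝ => C * √(2 * (√(κ * N) * √N)) := by fun_prop
  have hlim : Tendsto (fun κ : ℝ => C * √(2 * (√(κ * N) * √N))) (𝓝 0) (𝓝 0) := by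
    simpa using hcont.tendsto 0
  obtain ⟨κ₀, hκ₀, hsmall⟩ := Metric.eventually_nhds_iff.1
    (hlim.eventually (gt_mem_nhds (half_pos hη)))
  refine ⟨κ₀, hκ₀, fun κ w hκ hκ' hw h => ?_⟩
  obtain ⟨h1, h2, h3⟩ := energy_bounds hw hμ hκ h
  have hb : ∀ t ≤ T, ∫ ω, (timeInt w t ω) ^ 2 ∂P ≤ √(2 * (√(κ * N) * √N)) ^ 2 := by
    intro t ht
    rw [Real.sq_sqrt (by positivity)]
    refine (hw.integral_sq_timeInt_le ht).trans ?_
    gcongr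
  have h4 := hC w _ hw h2 (Real.sqrt_nonneg _) hb
  have h5 := hsmall (y := κ) (by rwa [Real.dist_eq, sub_zero, abs_of_pos hκ])
  linarith

end DealerMarket

end

theorem lemma3 {Ω : Type*} [mΩ : MeasurableSpace Ω] (P : Measure Ω) [IsProbabilityMeasure P]
    (𝓕 : Filtration ℝ≥0 mΩ) (h𝓕 : DealerMarket.UsualConditions P 𝓕)
    (T : ℝ≥0) (hT : 0 < T)
    (DT : Ω → ℝ) (hDT : StronglyMeasurable[𝓕 T] DT) (hDT2 : MemLp DT 2 P)
    (D : ℝ≥0 → Ω → ℝ) (hD : DealerMarket.IsExpectedDividend P 𝓕 T DT D)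
    (M : ℕ) (hM : 1 ≤ M) (ρd : ℝ) (hρd : 0 < ρd)
    (μN : ℝ≥0 → Ω → ℝ) (hμN : DealerMarket.MemS2 P 𝓕 T μN)
    (hμN_cont : ∀ᵐ ω ∂P, ContinuousOn (fun t => μN t ω) (Set.Icc 0 T))
    (KN : ℝ≥0 → Ω → ℝ) (hKN : ∀ᵐ ω ∂P, ∀ t ≤ T, KN t ω = DealerMarket.timeInt μN t ω) :
    (∃ I_D : Ω → ℝ, DealerMarket.IsStochasticIntegral P T KN D I_D) ∧
    (∀ (lam : ℝ) (S : ℝ≥0 → Ω → ℝ) (K u : Fin M → ℝ≥0 → Ω → ℝ), 0 < lam →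
      DealerMarket.IsEquilibrium P 𝓕 T DT (DealerMarket.dealers Ω M ρd) lam KN S K u →
      ∃ I_S : Ω → ℝ, DealerMarket.IsStochasticIntegral P T KN S I_S) ∧
    ∀ ε : ℝ, 0 < ε → ∃ lam₀ : ℝ, 0 < lam₀ ∧
      ∀ (lam : ℝ) (S : ℝ≥0 → Ω → ℝ) (K u : Fin M → ℝ≥0 → Ω → ℝ), 0 < lam → lam < lam₀ →
        DealerMarket.IsEquilibrium P 𝓕 T DT (DealerMarket.dealers Ω M ρd) lam KN S K u →
        ∀ I_D I_S : Ω → ℝ,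
          DealerMarket.IsStochasticIntegral P T KN D I_D →
          DealerMarket.IsStochasticIntegral P T KN S I_S →
          Integrable (fun ω => I_D ω - I_S ω
            - lam * ((M + 1) / M) * DealerMarket.timeInt (fun t ω => (μN t ω) ^ 2) T ω) P ∧
          ∫ ω, |I_D ω - I_S ω
            - lam * ((M + 1) / M) * DealerMarket.timeInt (fun t ω => (μN t ω) ^ 2) T ω| ∂P
            ≤ ε * lam := by
  open DealerMarket in
  have hμ : MemL2 P 𝓕 T μN := hμN.memL2
  have hKm := fun t (ht : t ≤ T) => aestronglyMeasurable_demand hμ hKN ht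
  refine ⟨⟨_, isStochasticIntegral_of_cadlag (fun t ht => hD.aestronglyMeasurable ht) hKm hD.2
    hμ.sqInt.ae_integrable hKN⟩, fun lam S K u _ hE => ?_, fun ε hε => ?_⟩
  · obtain ⟨-, -, -, A, hS, -⟩ := hE
    exact ⟨_, isStochasticIntegral_of_cadlag (fun t ht => hS.aestronglyMeasurable ht) hKm
      hS.ae_isCadlagOn hμ.sqInt.ae_integrable hKN⟩
  set c : ℝ := (M + 1) / M with hcdef
  have hc : 0 < c := by
    have : (0 : ℝ) < M := by exact_mod_cast hM
    positivity
  set N := ∫ z, onProd μN z ^ 2 ∂prodMeasure P T with hNdef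
  -- The `L¹`-error is at most `λ c ‖w‖ ‖μN‖` with `w = ū - μN`, so `‖w‖ ≤ ε / (c (‖μN‖ + 1))`
  -- suffices.
  have hη : 0 < (ε / (c * (√N + 1))) ^ 2 := by positivity
  obtain ⟨κ₀, hκ₀, hsmall⟩ := exists_energy_small hμ.sqInt hμN_cont hη
  refine ⟨κ₀ / (c * ρd), by positivity, fun lam S K u hlam hlt hE I_D I_S hID hIS => ?_⟩
  have hū := memL2_average fun a => (hE.2.1 a).2
  set w : ℝ≥0 → Ω → ℝ := fun t ω => average u t ω - μN t ω with hw
  have hwL : MemL2 P 𝓕 T w := hū.sub hμ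
  have hfoc := hE.rate_firstOrder hM hμ hKN hwL
  -- Testing the first-order condition with `w` itself gives the energy identity.
  have henergy : lam * (c * ρd) * ∫ z, (onProd w z + onProd μN z) * onProd w z ∂prodMeasure P T
      + ∫ z, onProd (timeInt w) z ^ 2 ∂prodMeasure P T = 0 := by
    have e1 : ∀ z, onProd w z + onProd μN z = onProd (average u) z := fun z => by
      simp only [hw, onProd]; ring
    simp only [e1, pow_two]
    have := congrArg (ρd * ·) hfoc
    simp only [mul_add, mul_zero, ← mul_assoc, mul_one_div_cancel hρd.ne', one_mul] at this
    linarith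
  have hW := hsmall _ w (by positivity) ((lt_div_iff₀ (by positivity)).1 hlt) hwL.sqInt henergy
  have hwμ := integrable_mul_of_memLp hwL.memLp hμ.memLp
  have heq : (fun ω => I_D ω - I_S ω - lam * c * timeInt (fun t ω => (μN t ω) ^ 2) T ω)
      =ᵐ[P] fun ω => lam * c * ∫ s, onProd w (ω, s) * onProd μN (ω, s) ∂timeMeasure T := by
    filter_upwards [hE.ae_liquidityCost_eq hDT hDT2 hD hM hμ hKN hID hIS, hū.sqInt.ae_memLp,
      hμ.sqInt.ae_memLp] with ω h1 h2 h3
    rw [h1, timeInt_eq, ← hcdef, ← mul_sub]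
    change lam * c * (_ - ∫ s, μN s ω ^ 2 ∂timeMeasure T) = _
    rw [← integral_sub (integrable_mul_of_memLp h2 h3) h3.integrable_sq]
    congr 2; ext s
    simp only [onProd, hw]
    ring
  have hlc : 0 < lam * c := by positivity
  refine ⟨(hwμ.integral_prod_left.const_mul _).congr heq.symm, ?_⟩
  calc ∫ ω, |I_D ω - I_S ω - lam * c * timeInt (fun t ω => (μN t ω) ^ 2) T ω| ∂P
      = ∫ ω, lam * c * |∫ s, onProd w (ω, s) * onProd μN (ω, s) ∂timeMeasure T| ∂P := by
        refine integral_congr_ae ?_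
        filter_upwards [heq] with ω hω
        rw [hω, abs_mul, abs_of_pos hlc]
    _ ≤ ∫ ω, lam * c * ∫ s, |onProd w (ω, s) * onProd μN (ω, s)| ∂timeMeasure T ∂P := by
        refine integral_mono (hwμ.integral_prod_left.abs.const_mul _)
          (hwμ.abs.integral_prod_left.const_mul _) fun ω => ?_
        exact mul_le_mul_of_nonneg_left abs_integral_le_integral_abs hlc.le
    _ = lam * c * ∫ z, |onProd w z * onProd μN z| ∂prodMeasure P T := by
        rw [integral_const_mul, integral_prodMeasure hwμ.abs]
    _ ≤ lam * c * (√(∫ z, onProd w z ^ 2 ∂prodMeasure P T) * √N) :=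
        mul_le_mul_of_nonneg_left (abs_integral_mul_le hwL.memLp hμ.memLp) hlc.le
    _ ≤ lam * c * (ε / (c * (√N + 1)) * (√N + 1)) := by
        gcongr
        · exact Real.sqrt_le_iff.2 ⟨by positivity, hW⟩
        · linarith
    _ = ε * lam := by
        have : 0 < √N + 1 := by positivity
        field_simp
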